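/- Let $N\ge 3$, $\lambda\in\mathbb R\setminus\{0\}$, $R>0$ and $\Omega\in\mathbb R$. Consider $N+1$ point vortices $z_1,\dots,z_{N+1}\in\mathbb C$, pairwise distinct, of strengths $\lambda_1=\dots=\lambda_N=1$ and $\lambda_{N+1}=\lambda$, on a plane that rotates with angular velocity $\Omega$ about the origin (a non-rotating plane if $\Omega=0$): $$\dot z_j=i\Omega z_j+\overline{\frac1{2\pi i}\sum_{k\ne j}\frac{\lambda_k}{z_j-z_k}},\qquad j=1,\dots,N+1 .$$ These are Hamilton's equations $\omega(\dot z,\cdot)=dH(z)$, i.e. $\lambda_j\dot x_j=-\partial H/\partial y_j$, $\lambda_j\dot y_j=\partial H/\partial x_j$, for $\omega=\sum_j\lambda_j\,dy_j\wedge dx_j$ and $H=\Omega J+\frac1{4\pi}\sum_{j<k}\lambda_j\lambda_k\ln|z_j-z_k|^2$, where $J=\frac12\sum_j\lambda_j|z_j|^2$ is the momentum map of the group $SO(2)$ of rotations about the origin. Let $x_e$ be the configuration $z_j=Re^{2\pi i j/N}$ $(1\le j\le N)$, $z_{N+1}=0$: a regular $N$-gon of unit vortices with a central vortex of strength $\lambda$.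 Then $x_e$ is a relative equilibrium: it rotates rigidly about the origin with angular velocity $\xi=\Omega+\frac{N-1+2\lambda}{4\pi R^2}$. Let $H_\xi=H-\xi J$, let $\mathcal N$ be the orthogonal complement in $\ker dJ(x_e)$ of the tangent space of the $SO(2)$-orbit of $x_e$, and let $L$ be the endomorphism of $\mathcal N$ given by $\omega(Lu,v)=d^2H_\xi(x_e)(u,v)$ for $u,v\in\mathcal N$. Call $x_e$ - *Lyapunov stable* (modulo $SO(2)$) if for each $SO(2)$-invariant open neighbourhood $U$ of its orbit there is a neighbourhood $V\subseteq U$ of $x_e$ such that the trajectories starting in $V$ exist and stay in $U$ for all $t\ge 0$; - *elliptic* if all eigenvalues of $L$ are purely imaginary (spectral stability) and $d^2H_\xi(x_e)$ is not definite on $\mathcal N$; - *linearly unstable* if $\dot u=Lu$ has a solution that is unbounded on $t\ge0$; - *spectrally unstable* if $L$ has an eigenvalue with positive real part. Let $\varepsilon_N=1$ if $N$ is even and $\varepsilon_N=0$ if $N$ is odd. If $N\ge4$, then $x_e$ is Lyapunov stable if $\max\bigl(0,\frac{N^2-8N+7+\varepsilon_N}{16}\bigr)<\lambda<\frac{(N-1)^2}{4}$;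 it is elliptic if $\frac{N^2-8N+7+\varepsilon_N}{16}<\lambda<0$; and it is linearly unstable for all other $\lambda\ne0$, even spectrally unstable if $\lambda<\frac{N^2-8N+7+\varepsilon_N}{16}$ or $\lambda>\frac{(N-1)^2}{4}$. If $N=3$, then $x_e$ is Lyapunov stable if $0<\lambda<1$, elliptic if $\lambda<0$, and linearly (and spectrally) unstable if $\lambda>1$. -/

import Mathlib

namespace PointVortex

noncomputable section

variable {ι : Type} [Fintype ι] [DecidableEq ι]

/-- The phase space of the vortices labelled by `ι` on the plane `ℂ`:
no two vortices are at the same place. -/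
def phaseSpace (ι : Type) : Set (ι → ℂ) := {z | Function.Injective z}

/-- Equations of motion of point vortices with strengths `Γ` on a plane rotating with constant
angular velocity `Ω`: the velocity of the vortex `j` is `i Ω z_j` plus the complex conjugate of
`(1 / (2 π i)) ∑_{k ≠ j} Γ_k / (z_j - z_k)`. The plane does not rotate if `Ω = 0`. -/
def velocity (Γ : ι → ℝ) (Ω : ℝ) (z : ι → ℂ) : ι → ℂ := fun j =>
  Complex.I * (Ω : ℂ) * z j +
    (starRingEnd ℂ) (1 / (2 * (Real.pi : ℂ) * Complex.I) *
      ∑ k ∈ Finset.univ.erase j, (Γ k : ℂ) / (z j - z k))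

/-- `γ` is a solution, on the set of times `s`, of the equations of motion in the phase space. -/
def IsTrajectory (Γ : ι → ℝ) (Ω : ℝ) (γ : ℝ → ι → ℂ) (s : Set ℝ) : Prop :=
  ∀ t ∈ s, γ t ∈ phaseSpace ι ∧ HasDerivWithinAt γ (velocity Γ Ω (γ t)) s t

/-- The diagonal action of `SO(2)`: rotation by the angle `θ` around the origin. -/
def rotate (θ : ℝ) (z : ι → ℂ) : ι → ℂ := fun j => Complex.exp ((θ : ℂ) * Complex.I) * z j

/-- `x` is a relative equilibrium with angular velocity `ξ`: the trajectory of `x` is the rigid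
rotation of `x` around the origin with angular velocity `ξ`. -/
def IsRelativeEquilibrium (Γ : ι → ℝ) (Ω : ℝ) (x : ι → ℂ) (ξ : ℝ) : Prop :=
  IsTrajectory Γ Ω (fun t => rotate (ξ * t) x) Set.univ

/-- Lyapunov stability modulo `SO(2)`: for each rotation invariant open neighbourhood `U` of the
orbit of `x` there is an open neighbourhood `V` of `x` such that the trajectories starting in `V`
exist and stay in `U` for all times `t ≥ 0`. -/
def LyapunovStable (Γ : ι → ℝ) (Ω : ℝ) (x : ι → ℂ) : Prop :=
  ∀ U : Set (ι → ℂ), IsOpen U → (∀ (θ : ℝ), ∀ y ∈ U, rotate θ y ∈ U) → x ∈ U →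
    ∃ V : Set (ι → ℂ), IsOpen V ∧ x ∈ V ∧ V ⊆ U ∧ ∀ y ∈ V,
      (∃ γ : ℝ → ι → ℂ, IsTrajectory Γ Ω γ (Set.Ici 0) ∧ γ 0 = y) ∧
      ∀ γ : ℝ → ι → ℂ, IsTrajectory Γ Ω γ (Set.Ici 0) → γ 0 = y → ∀ t : ℝ, 0 ≤ t → γ t ∈ U

/-- The symplectic form `∑_j Γ_j dy_j ∧ dx_j`, for which Hamilton's equations `ω (X, ·) = dH` are
`Γ_j dx_j/dt = - ∂H/∂y_j`, `Γ_j dy_j/dt = ∂H/∂x_j`. -/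
def symplecticForm (Γ : ι → ℝ) (u v : ι → ℂ) : ℝ :=
  ∑ j, Γ j * ((u j).im * (v j).re - (u j).re * (v j).im)

/-- The momentum map of the rotations around the origin. -/
def momentum (Γ : ι → ℝ) (z : ι → ℂ) : ℝ := (1 / 2) * ∑ j, Γ j * ‖z j‖ ^ 2

/-- The Hamiltonian of the equations of motion on the rotating plane, for the symplectic form
above. The double sum runs over ordered pairs, so that every pair is counted twice. -/
def hamiltonian (Γ : ι → ℝ) (Ω : ℝ) (z : ι → ℂ) : ℝ :=
  Ω * momentum Γ z + 1 / (4 * Real.pi) *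
    ((1 / 2) * ∑ j, ∑ k ∈ Finset.univ.erase j, Γ j * Γ k * Real.log (‖z j - z k‖ ^ 2))

/-- The augmented Hamiltonian `H - ξ J`, up to an additive constant. -/
def augmentedHamiltonian (Γ : ι → ℝ) (Ω ξ : ℝ) (z : ι → ℂ) : ℝ :=
  hamiltonian Γ Ω z - ξ * momentum Γ z

/-- The symplectic slice at `x`: the vectors in the kernel of `dJ(x)` that are orthogonal, for the
Euclidean inner product, to the tangent space `ℝ · i x` of the `SO(2)`-orbit of `x`. -/
def slice (Γ : ι → ℝ) (x : ι → ℂ) : Submodule ℝ (ι → ℂ) where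
  carrier := {v | fderiv ℝ (momentum Γ) x v = 0 ∧
    ∑ j, ((Complex.I * x j).re * (v j).re + (Complex.I * x j).im * (v j).im) = 0}
  zero_mem' := by simp
  add_mem' := by
    rintro u v ⟨hu, hu'⟩ ⟨hv, hv'⟩
    refine ⟨by rw [map_add, hu, hv, add_zero], ?_⟩
    rw [← add_zero (0 : ℝ)]
    nth_rewrite 1 [← hu']
    rw [← hv', ← Finset.sum_add_distrib]
    refine Finset.sum_congr rfl fun j _ => ?_
    simp only [Pi.add_apply, Complex.add_re, Complex.add_im]
    ring
  smul_mem' := by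
    rintro c v ⟨hv, hv'⟩
    refine ⟨by rw [map_smul, hv, smul_zero], ?_⟩
    rw [← mul_zero c, ← hv', Finset.mul_sum]
    refine Finset.sum_congr rfl fun j _ => ?_
    simp only [Pi.smul_apply, Complex.real_smul, Complex.re_ofReal_mul, Complex.im_ofReal_mul]
    ring

/-- The second derivative at `x` of the augmented Hamiltonian. -/
def hessian (Γ : ι → ℝ) (Ω ξ : ℝ) (x u v : ι → ℂ) : ℝ :=
  fderiv ℝ (fderiv ℝ (augmentedHamiltonian Γ Ω ξ)) x u v

/-- The second derivative of the augmented Hamiltonian is (positive or negative) definite on the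
symplectic slice at `x`. -/
def DefiniteOnSlice (Γ : ι → ℝ) (Ω ξ : ℝ) (x : ι → ℂ) : Prop :=
  (∀ u ∈ slice Γ x, u ≠ 0 → 0 < hessian Γ Ω ξ x u u) ∨
  (∀ u ∈ slice Γ x, u ≠ 0 → hessian Γ Ω ξ x u u < 0)

/-- `L` is the linearization of the motion in the symplectic slice at `x`, that is the composition
of `d²H_ξ(x)` with the inverse of the symplectic form, both restricted to the slice. -/
def IsSliceLinearization (Γ : ι → ℝ) (Ω ξ : ℝ) (x : ι → ℂ)
    (L : Module.End ℝ (slice Γ x)) : Prop :=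
  ∀ u v : slice Γ x, symplecticForm Γ (L u) v = hessian Γ Ω ξ x u v

/-- All (complex) eigenvalues of the linearization in the slice are purely imaginary. -/
def SpectrallyStable (Γ : ι → ℝ) (Ω ξ : ℝ) (x : ι → ℂ) : Prop :=
  ∃ L : Module.End ℝ (slice Γ x), IsSliceLinearization Γ Ω ξ x L ∧
    ∀ m : ℂ, Module.End.HasEigenvalue (LinearMap.baseChange ℂ L) m → m.re = 0

/-- Some (complex) eigenvalue of the linearization in the slice has a positive real part. -/
def SpectrallyUnstable (Γ : ι → ℝ) (Ω ξ : ℝ) (x : ι → ℂ) : Prop :=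
  ∃ L : Module.End ℝ (slice Γ x), IsSliceLinearization Γ Ω ξ x L ∧
    ∃ m : ℂ, Module.End.HasEigenvalue (LinearMap.baseChange ℂ L) m ∧ 0 < m.re

/-- Some solution of the linearized equations in the slice is unbounded in the future. -/
def LinearlyUnstable (Γ : ι → ℝ) (Ω ξ : ℝ) (x : ι → ℂ) : Prop :=
  ∃ L : Module.End ℝ (slice Γ x), IsSliceLinearization Γ Ω ξ x L ∧
    ∃ u : ℝ → slice Γ x, (∀ t : ℝ, HasDerivAt u (L (u t)) t) ∧
      ¬ ∃ C : ℝ, ∀ t : ℝ, 0 ≤ t → ‖u t‖ ≤ C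

/-- Elliptic: spectrally stable, with a second derivative that is not definite on the slice. -/
def Elliptic (Γ : ι → ℝ) (Ω ξ : ℝ) (x : ι → ℂ) : Prop :=
  SpectrallyStable Γ Ω ξ x ∧ ¬ DefiniteOnSlice Γ Ω ξ x

/-- The strengths of `N` unit vortices and a central vortex (labelled `none`) of strength `l`. -/
def ringStrength (N : ℕ) (l : ℝ) : Option (Fin N) → ℝ
  | none => l
  | some _ => 1

/-- The regular `N`-gon of radius `R` around the origin, and a vortex at the origin. -/
def ringWithCentre (N : ℕ) (R : ℝ) : Option (Fin N) → ℂ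
  | none => 0
  | some j => (R : ℂ) * Complex.exp (2 * (Real.pi : ℂ) * ((j : ℕ) : ℂ) / (N : ℂ) * Complex.I)

/-- The angular velocity of the ring of radius `R` with its central vortex. -/
def ringAngularVelocity (N : ℕ) (l R Ω : ℝ) : ℝ :=
  Ω + ((N : ℝ) - 1 + 2 * l) / (4 * Real.pi * R ^ 2)

/-- `(N² - 8 N + 7 + ε_N) / 16`, where `ε_N` is `1` for even `N` and `0` for odd `N`. -/
def lowerThreshold (N : ℕ) : ℝ :=
  ((N : ℝ) ^ 2 - 8 * (N : ℝ) + 7 + (if Even N then 1 else 0)) / 16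

end

end PointVortex

/-! Write `E_j` for the vertices of the ring and `w_j` for a displacement `u_j = E_j w_j` in the
frame turning with them. The proof rests on three facts.

* **Hamiltonian structure.** On the phase space `dH (z) = ω (X (z), ·)` for the vector field `X` of
  the motion (`fderiv_hamiltonian_apply`), and `H - ξ J` is the Hamiltonian of a plane rotating with
  angular velocity `Ω - ξ`. So `d²H_ξ (x) (u, v) = ω (DX (x) u, v)` (`hessian_eq`), and `L` is the
  restriction to the slice of the derivative of the vector field in the corotating frame.

* **Fourier modes.** The slice is the set of displacements with vanishing Fourier coefficient of
  index `0`, and the linearization couples the index `k` only with `-k`, and for `k = ±1` also with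
  the central vortex (`coeff_linearization`, `linearization_mode`). This comes from evaluating
  `∑_{k ≠ j} (E_j ^ n - E_k ^ n) / (E_j - E_k) ^ 2` by a recursion in `n` (`secondSum_succ_eq`). With
  `A = N - 1 + 2 l` and `B_k = (k - 1) (N - k - 1) - 2 l`, and with `frequency R` as the unit, a pair
  of modes has the squared frequency `A ^ 2 - B_k ^ 2`, where `A + B_k = k (N - k)` is positive and `A - B_k` is smallest for
  `k = ⌊N / 2⌋`, when it is `4 (l - lowerThreshold N)`. The modes that move the central vortex have
  the squared frequencies `A ^ 2` and `(N - 1) ^ 2 - 4 l`. Below the lower or above the upper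
  threshold there is a growing mode; at a threshold there is a Jordan block for the eigenvalue `0`;
  in between all frequencies are real (`spectrallyStable_ring`). For `l < 0` the second derivative is
  indefinite or degenerate on the span of a displacement of the centre and a translation of the
  ring (`not_definiteOnSlice_ring`).

* **Energy.** For `l > 0` between the thresholds, Parseval's identity shows that the second
  derivative is negative definite on all displacements orthogonal to the orbit, not only on those in
  the slice (`symplecticForm_linearization_neg`). So `H_ξ` has a strict maximum along these, and as
  `H_ξ` is conserved and rotation invariant it confines all motions that start near the orbit. They
  exist for all times because a bounded Lipschitz vector field that agrees with `X` near the orbit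
  has global integral curves, and `H_ξ` confines these as well (`lyapunovStable_of_negDef`). -/

namespace PointVortex

open Finset
open scoped Topology TensorProduct

variable {N : ℕ} {l R : ℝ}

/-! ### Sums over roots of unity -/

/-- The vertex `exp (2 π i j / N)` of the regular `N`-gon inscribed in the unit circle. -/
noncomputable def vertex (N : ℕ) (j : Fin N) : ℂ :=
  Complex.exp (2 * (Real.pi : ℂ) * ((j : ℕ) : ℂ) / (N : ℂ) * Complex.I)

lemma vertex_eq_pow (j : Fin N) :
    vertex N j = Complex.exp (2 * (Real.pi : ℂ) * Complex.I / (N : ℂ)) ^ (j : ℕ) := by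
  rw [vertex, ← Complex.exp_nat_mul]
  congr 1
  ring

lemma vertex_ne_zero (j : Fin N) : vertex N j ≠ 0 := Complex.exp_ne_zero _

lemma norm_vertex (j : Fin N) : ‖vertex N j‖ = 1 := by
  have : vertex N j = Complex.exp (((2 * Real.pi * (j : ℕ) / N : ℝ) : ℂ) * Complex.I) := by
    rw [vertex]; push_cast; rfl
  rw [this, Complex.norm_exp_ofReal_mul_I]

lemma conj_vertex (j : Fin N) : (starRingEnd ℂ) (vertex N j) = (vertex N j)⁻¹ :=
  (Complex.inv_eq_conj (norm_vertex j)).symm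

lemma vertex_pow_card (j : Fin N) : vertex N j ^ N = 1 := by
  have hN : N ≠ 0 := by have := j.2; omega
  rw [vertex_eq_pow, pow_right_comm, (Complex.isPrimitiveRoot_exp N hN).pow_eq_one, one_pow]

lemma vertex_injective : Function.Injective (vertex N) := by
  intro j k h
  have hN : N ≠ 0 := by have := j.2; omega
  rw [vertex_eq_pow, vertex_eq_pow] at h
  exact Fin.ext ((Complex.isPrimitiveRoot_exp N hN).pow_inj j.2 k.2 h)

lemma vertex_zpow_eq_of_dvd {m n : ℤ} (h : (N : ℤ) ∣ m - n) (j : Fin N) :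
    vertex N j ^ m = vertex N j ^ n := by
  obtain ⟨q, hq⟩ := h
  rw [show m = n + N * q by omega, zpow_add₀ (vertex_ne_zero j), zpow_mul, zpow_natCast,
    vertex_pow_card, one_zpow, mul_one]

lemma sum_vertex_zpow (n : ℤ) :
    ∑ j : Fin N, vertex N j ^ n = if (N : ℤ) ∣ n then (N : ℂ) else 0 := by
  split_ifs with h
  · rw [Finset.sum_congr rfl fun j _ => (vertex_zpow_eq_of_dvd (n := 0) (by simpa using h) j)]
    simp
  · rcases Nat.eq_zero_or_pos N with hN | hN
    · subst hN; simp
    have hp := Complex.isPrimitiveRoot_exp N hN.ne'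
    set w := Complex.exp (2 * (Real.pi : ℂ) * Complex.I / (N : ℂ)) with hw
    have h1 : w ^ n ≠ 1 := fun h' => h ((hp.zpow_eq_one_iff_dvd n).1 h')
    have : ∀ j : Fin N, vertex N j ^ n = (w ^ n) ^ (j : ℕ) := by
      intro j
      rw [vertex_eq_pow, ← hw, ← zpow_natCast, ← zpow_natCast, ← zpow_mul, ← zpow_mul, mul_comm]
    rw [Finset.sum_congr rfl fun j _ => this j,
      Fin.sum_univ_eq_sum_range (fun i => (w ^ n) ^ i), geom_sum_eq h1]
    rw [← zpow_natCast, ← zpow_mul, mul_comm, zpow_mul, zpow_natCast, hp.pow_eq_one]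
    simp

lemma sum_vertex_pow (n : ℕ) :
    ∑ j : Fin N, vertex N j ^ n = if N ∣ n then (N : ℂ) else 0 := by
  have := sum_vertex_zpow (N := N) n
  simpa [Int.natCast_dvd_natCast] using this

/-- `∑_{k ≠ j} E_k ^ n / (E_j - E_k)` for the vertices `E_k` of the `N`-gon. -/
noncomputable def firstSum (N n : ℕ) (j : Fin N) : ℂ :=
  ∑ k ∈ univ.erase j, vertex N k ^ n / (vertex N j - vertex N k)

/-- `∑_{k ≠ j} (E_j ^ n - E_k ^ n) / (E_j - E_k) ^ 2` for the vertices `E_k` of the `N`-gon. -/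
noncomputable def secondSum (N n : ℕ) (j : Fin N) : ℂ :=
  ∑ k ∈ univ.erase j, (vertex N j ^ n - vertex N k ^ n) / (vertex N j - vertex N k) ^ 2

lemma vertex_sub_ne_zero {j k : Fin N} (h : k ∈ univ.erase j) : vertex N j - vertex N k ≠ 0 :=
  sub_ne_zero.2 fun h' => (ne_of_mem_erase h) (vertex_injective h').symm

lemma secondSum_succ (n : ℕ) (j : Fin N) :
    secondSum N (n + 1) j = vertex N j * secondSum N n j + firstSum N n j := by
  rw [secondSum, secondSum, firstSum, Finset.mul_sum, ← Finset.sum_add_distrib]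
  refine Finset.sum_congr rfl fun k hk => ?_
  have := vertex_sub_ne_zero hk
  field_simp
  ring

lemma firstSum_succ (n : ℕ) (j : Fin N) :
    firstSum N (n + 1) j =
      vertex N j * firstSum N n j + vertex N j ^ n - if N ∣ n then (N : ℂ) else 0 := by
  rw [← sum_vertex_pow, ← Finset.add_sum_erase univ _ (mem_univ j), firstSum, firstSum,
    Finset.mul_sum, add_sub_assoc, sub_add_cancel_left, ← sub_eq_add_neg,
    ← Finset.sum_sub_distrib]
  refine Finset.sum_congr rfl fun k hk => ?_
  have := vertex_sub_ne_zero hk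
  field_simp
  ring

lemma firstSum_eq_of_zero (j : Fin N) {n : ℕ} (h1 : 1 ≤ n) (hn : n ≤ N) :
    vertex N j * firstSum N n j =
      vertex N j ^ n * (vertex N j * firstSum N 0 j + n - N) := by
  induction n, h1 using Nat.le_induction with
  | base => rw [firstSum_succ]; simp
  | succ n hn' ih =>
    rw [firstSum_succ, if_neg (fun h => by have := Nat.le_of_dvd hn' h; omega), sub_zero, mul_add,
      mul_left_comm, ih (by omega)]
    push_cast
    ring

lemma secondSum_eq_of_zero (j : Fin N) {n : ℕ} (h1 : 1 ≤ n) (hn : n ≤ N + 1) :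
    vertex N j ^ 2 * secondSum N n j =
      vertex N j ^ n * (n * (vertex N j * firstSum N 0 j) + n * (n - 1) / 2 - (n - 1) * N) := by
  induction n, h1 using Nat.le_induction with
  | base =>
    rw [secondSum_succ]
    simp [secondSum]
    ring
  | succ n hn' ih =>
    have h2 := firstSum_eq_of_zero j hn' (by omega)
    rw [secondSum_succ, mul_add, mul_left_comm, ih (by omega), pow_two (vertex N j), mul_assoc, h2]
    push_cast
    ring

lemma vertex_mul_firstSum_zero (j : Fin N) : vertex N j * firstSum N 0 j = ((N : ℂ) - 1) / 2 := by
  have hN : 1 ≤ N := by have := j.2; omega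
  -- `secondSum N n j` is periodic in `n` and vanishes for `n = 0`
  have h0 : secondSum N N j = 0 :=
    Finset.sum_eq_zero fun k _ => by rw [vertex_pow_card, vertex_pow_card, sub_self, zero_div]
  have h := secondSum_eq_of_zero j hN (by omega)
  rw [h0, mul_zero, vertex_pow_card, one_mul] at h
  have hN' : (N : ℂ) ≠ 0 := by exact_mod_cast (by omega : N ≠ 0)
  have : (N : ℂ) * (vertex N j * firstSum N 0 j - ((N : ℂ) - 1) / 2) = 0 := by
    rw [h]; ring
  exact sub_eq_zero.1 ((mul_eq_zero.1 this).resolve_left hN')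

lemma secondSum_succ_eq (j : Fin N) {k : ℕ} (hk : k ≤ N) :
    secondSum N (k + 1) j = -((k - 1) * (N - k - 1) / 2) * vertex N j ^ ((k : ℤ) - 1) := by
  have h := secondSum_eq_of_zero j (n := k + 1) (by omega) (by omega)
  rw [vertex_mul_firstSum_zero] at h
  have h0 := vertex_ne_zero j
  rw [zpow_sub₀ h0, zpow_natCast, zpow_one]
  field_simp
  push_cast at h
  rw [pow_succ] at h
  apply mul_left_cancel₀ h0
  linear_combination 2 * h

/-! ### The discrete Fourier transform on the ring -/

/-- The Fourier coefficient `∑_j E_j ^ (-(k + 1)) u_j` of a displacement `u` of the ring. With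
`u_j = E_j w_j` it is the coefficient of index `k` of `w`, the displacement in the frame that turns
with the vertices. -/
noncomputable def coeff (k : ℤ) (u : Fin N → ℂ) : ℂ :=
  ∑ j, vertex N j ^ (-(k + 1)) * u j

lemma coeff_congr {m n : ℤ} (h : (N : ℤ) ∣ m - n) (u : Fin N → ℂ) : coeff m u = coeff n u := by
  refine Finset.sum_congr rfl fun j _ => ?_
  rw [vertex_zpow_eq_of_dvd (n := -(n + 1))]
  rw [show -(m + 1) - -(n + 1) = -(m - n) by ring]
  exact (Int.dvd_neg).2 h

lemma conj_coeff (k : ℤ) (u : Fin N → ℂ) :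
    (starRingEnd ℂ) (coeff k u) = ∑ j, vertex N j ^ (k + 1) * (starRingEnd ℂ) (u j) := by
  rw [coeff, map_sum]
  refine Finset.sum_congr rfl fun j _ => ?_
  rw [map_mul, map_zpow₀, conj_vertex, inv_zpow, zpow_neg, inv_inv]

/-- Parseval's identity. -/
lemma sum_coeff_mul_conj (u v : Fin N → ℂ) :
    ∑ k ∈ range N, coeff (k : ℤ) u * (starRingEnd ℂ) (coeff (k : ℤ) v) =
      N * ∑ j, u j * (starRingEnd ℂ) (v j) := by
  have key : ∀ i j : Fin N, ∑ k ∈ range N,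
      vertex N i ^ (-((k : ℤ) + 1)) * vertex N j ^ ((k : ℤ) + 1) = if i = j then (N : ℂ) else 0 := by
    intro i j
    have h0 := vertex_ne_zero i
    have : ∀ k : ℕ, vertex N i ^ (-((k : ℤ) + 1)) * vertex N j ^ ((k : ℤ) + 1) =
        (vertex N j / vertex N i) * (vertex N j / vertex N i) ^ k := by
      intro k
      rw [zpow_neg, ← Nat.cast_succ, zpow_natCast, zpow_natCast, ← pow_succ', div_pow]
      field_simp
    rw [Finset.sum_congr rfl fun k _ => this k, ← Finset.mul_sum]
    split_ifs with h
    · subst h; simp [h0]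
    · have h1 : vertex N j / vertex N i ≠ 1 := fun h' =>
        h (vertex_injective ((div_eq_one_iff_eq h0).1 h').symm)
      rw [geom_sum_eq h1, div_pow, vertex_pow_card, vertex_pow_card]
      simp
  simp_rw [conj_coeff, coeff, Finset.sum_mul_sum]
  rw [Finset.sum_comm, Finset.mul_sum]
  refine Finset.sum_congr rfl fun i _ => ?_
  rw [Finset.sum_comm]
  have : ∀ j : Fin N, ∑ k ∈ range N, vertex N i ^ (-((k : ℤ) + 1)) * u i *
      (vertex N j ^ ((k : ℤ) + 1) * (starRingEnd ℂ) (v j)) =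
      (if i = j then (N : ℂ) else 0) * (u i * (starRingEnd ℂ) (v j)) := by
    intro j
    rw [← key, Finset.sum_mul]
    exact Finset.sum_congr rfl fun k _ => by ring
  rw [Finset.sum_congr rfl fun j _ => this j]
  simp

lemma eq_zero_of_coeff_eq_zero {u : Fin N → ℂ} (h : ∀ k ∈ range N, coeff (k : ℤ) u = 0) :
    u = 0 := by
  have h1 := sum_coeff_mul_conj u u
  rw [Finset.sum_eq_zero fun k hk => by rw [h k hk, zero_mul]] at h1
  funext j
  have hN : (N : ℂ) ≠ 0 := by have := j.2; exact_mod_cast (by omega : N ≠ 0)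
  have h2 := (mul_eq_zero.1 h1.symm).resolve_left hN
  have h3 : ∑ j, ‖u j‖ ^ 2 = 0 := by
    have : ((∑ j, ‖u j‖ ^ 2 : ℝ) : ℂ) = 0 := by
      rw [← h2]; push_cast
      exact Finset.sum_congr rfl fun j _ => (Complex.mul_conj' _).symm
    exact_mod_cast this
  have := (Finset.sum_eq_zero_iff_of_nonneg fun j _ => sq_nonneg ‖u j‖).1 h3 j (mem_univ j)
  simpa using this

/-! ### The Hamiltonian structure of the equations of motion -/

section Calculus

variable {ι : Type} [Fintype ι] [DecidableEq ι]

lemma sum_sum_erase_comm {M : Type*} [AddCommMonoid M] (f : ι → ι → M) :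
    ∑ j, ∑ k ∈ univ.erase j, f j k = ∑ j, ∑ k ∈ univ.erase j, f k j := by
  refine Finset.sum_comm' fun j k => ?_
  simp [eq_comm]

omit [DecidableEq ι] in
lemma isOpen_phaseSpace : IsOpen (phaseSpace ι) := by
  have : phaseSpace ι = ⋂ j : ι, ⋂ k : ι, {z | z j = z k → j = k} := by
    ext z; simp [phaseSpace, Function.Injective]
  rw [this]
  refine isOpen_iInter_of_finite fun j => isOpen_iInter_of_finite fun k => ?_
  by_cases h : j = k
  · simp [h]
  · simpa [h] using isOpen_ne_fun (continuous_apply j) (continuous_apply k)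

omit [Fintype ι] [DecidableEq ι] in
lemma sub_ne_zero_of_mem_phaseSpace {z : ι → ℂ} (hz : z ∈ phaseSpace ι) {j k : ι} (h : k ≠ j) :
    z j - z k ≠ 0 := sub_ne_zero.2 fun h' => h (hz h').symm

lemma contDiffAt_velocity (Γ : ι → ℝ) (Ω : ℝ) {z : ι → ℂ} (hz : z ∈ phaseSpace ι) :
    ContDiffAt ℝ 1 (velocity Γ Ω) z := by
  refine contDiffAt_pi.2 fun j => ?_
  have hp : ∀ k : ι, ContDiffAt ℝ 1 (fun z : ι → ℂ => z k) z := fun k =>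
    (contDiff_apply ℝ ℂ k).contDiffAt
  refine (contDiffAt_const.mul (hp j)).add ?_
  refine (Complex.conjCLE.contDiff.contDiffAt).comp z (contDiffAt_const.mul ?_)
  refine ContDiffAt.sum fun k hk => ?_
  simp only [div_eq_mul_inv]
  exact contDiffAt_const.mul (((hp j).sub (hp k)).inv
    (sub_ne_zero_of_mem_phaseSpace hz (ne_of_mem_erase hk)))

omit [Fintype ι] [DecidableEq ι] in
lemma hasDerivAt_line (z u : ι → ℂ) (j : ι) :
    HasDerivAt (fun t : ℝ => (z + t • u) j) (u j) 0 := by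
  have h := ((hasDerivAt_id (0 : ℝ)).smul_const (u j)).const_add (z j)
  simpa using h

omit [DecidableEq ι] in
lemma fderiv_apply_eq_of_line {F : Type*} [NormedAddCommGroup F] [NormedSpace ℝ F]
    {f : (ι → ℂ) → F} {z u : ι → ℂ} {f' : F} (hf : DifferentiableAt ℝ f z)
    (h : HasDerivAt (fun t : ℝ => f (z + t • u)) f' 0) : fderiv ℝ f z u = f' := by
  have hl : HasDerivAt (fun t : ℝ => z + t • u) u 0 := by
    simpa using ((hasDerivAt_id (0 : ℝ)).smul_const u).const_add z
  have hf' : HasFDerivAt f (fderiv ℝ f z) (z + (0 : ℝ) • u) := by simpa using hf.hasFDerivAt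
  exact (hf'.comp_hasDerivAt (0 : ℝ) hl).unique h

lemma fderiv_velocity_apply (Γ : ι → ℝ) (Ω : ℝ) {z : ι → ℂ} (hz : z ∈ phaseSpace ι)
    (u : ι → ℂ) (j : ι) :
    fderiv ℝ (velocity Γ Ω) z u j = Complex.I * (Ω : ℂ) * u j -
      (starRingEnd ℂ) (1 / (2 * (Real.pi : ℂ) * Complex.I) *
        ∑ k ∈ univ.erase j, (Γ k : ℂ) * ((u j - u k) / (z j - z k) ^ 2)) := by
  have hd := (contDiffAt_velocity Γ Ω hz).differentiableAt (by simp)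
  have hd' : DifferentiableAt ℝ (fun z => velocity Γ Ω z j) z := differentiableAt_pi.1 hd j
  have h1 : fderiv ℝ (velocity Γ Ω) z u j = fderiv ℝ (fun z => velocity Γ Ω z j) z u := by
    rw [fderiv_pi (differentiableAt_pi.1 hd)]; rfl
  rw [h1]
  refine fderiv_apply_eq_of_line hd' ?_
  have hs : ∀ k ∈ univ.erase j, HasDerivAt
      (fun t : ℝ => (Γ k : ℂ) / ((z + t • u) j - (z + t • u) k))
      (-((Γ k : ℂ) * ((u j - u k) / (z j - z k) ^ 2))) 0 := by
    intro k hk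
    have hne := sub_ne_zero_of_mem_phaseSpace hz (ne_of_mem_erase hk)
    have hsub := (hasDerivAt_line z u j).sub (hasDerivAt_line z u k)
    have := ((hasDerivAt_const (0 : ℝ) (Γ k : ℂ)).div hsub (by simpa using hne))
    refine this.congr_deriv ?_
    simp only [Pi.sub_apply, zero_smul, add_zero, zero_mul, zero_sub]
    ring
  have h2 := ((hasDerivAt_line z u j).const_mul (Complex.I * (Ω : ℂ))).add
    (Complex.conjCLE.hasFDerivAt.comp_hasDerivAt (0 : ℝ)
      ((HasDerivAt.fun_sum hs).const_mul (1 / (2 * (Real.pi : ℂ) * Complex.I))))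
  refine h2.congr_deriv ?_
  rw [Finset.sum_neg_distrib, mul_neg, map_neg, ← sub_eq_add_neg]
  rfl

lemma augmentedHamiltonian_eq (Γ : ι → ℝ) (Ω ξ : ℝ) :
    augmentedHamiltonian Γ Ω ξ = hamiltonian Γ (Ω - ξ) := by
  funext z; simp only [augmentedHamiltonian, hamiltonian]; ring

omit [DecidableEq ι] in
lemma contDiff_momentum (Γ : ι → ℝ) : ContDiff ℝ 2 (momentum Γ) := by
  unfold momentum
  refine contDiff_const.mul (ContDiff.sum fun j _ => contDiff_const.mul ?_)
  exact (contDiff_norm_sq ℝ).comp (contDiff_apply ℝ ℂ j)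

lemma contDiffAt_hamiltonian (Γ : ι → ℝ) (Ω : ℝ) {z : ι → ℂ} (hz : z ∈ phaseSpace ι) :
    ContDiffAt ℝ 2 (hamiltonian Γ Ω) z := by
  unfold hamiltonian
  refine (contDiffAt_const.mul (contDiff_momentum Γ).contDiffAt).add
    (contDiffAt_const.mul (contDiffAt_const.mul
      (ContDiffAt.sum fun j _ => ContDiffAt.sum fun k hk => ?_)))
  refine contDiffAt_const.mul (ContDiffAt.log ?_ ?_)
  · exact ((contDiff_norm_sq ℝ).comp
      ((contDiff_apply ℝ ℂ j).sub (contDiff_apply ℝ ℂ k))).contDiffAt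
  · have := sub_ne_zero_of_mem_phaseSpace hz (ne_of_mem_erase hk)
    simpa using this

omit [Fintype ι] [DecidableEq ι] in
lemma hasDerivAt_norm_sq_line {f : ℝ → ℂ} {f' : ℂ} (h : HasDerivAt f f' 0) :
    HasDerivAt (fun t : ℝ => ‖f t‖ ^ 2) (2 * ((f 0).re * f'.re + (f 0).im * f'.im)) 0 := by
  have := h.norm_sq
  convert this using 2
  simp [Complex.inner]
  ring

omit [DecidableEq ι] in
lemma hasDerivAt_momentum_line (Γ : ι → ℝ) (z v : ι → ℂ) :
    HasDerivAt (fun t : ℝ => momentum Γ (z + t • v))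
      (∑ j, Γ j * ((z j).re * (v j).re + (z j).im * (v j).im)) 0 := by
  have h := (HasDerivAt.fun_sum fun j (_ : j ∈ univ) =>
    (hasDerivAt_norm_sq_line (hasDerivAt_line z v j)).const_mul (Γ j)).const_mul (1 / 2 : ℝ)
  refine h.congr_deriv ?_
  rw [Finset.mul_sum]
  refine Finset.sum_congr rfl fun j _ => ?_
  simp
  ring

omit [DecidableEq ι] in
lemma fderiv_momentum_apply (Γ : ι → ℝ) (z v : ι → ℂ) :
    fderiv ℝ (momentum Γ) z v = ∑ j, Γ j * ((z j).re * (v j).re + (z j).im * (v j).im) :=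
  fderiv_apply_eq_of_line ((contDiff_momentum Γ).differentiable (by simp) z)
    (hasDerivAt_momentum_line Γ z v)

/-- Hamilton's equations: `dH (z) = ω (X (z), ·)` for the vector field `X` of the motion. -/
lemma fderiv_hamiltonian_apply (Γ : ι → ℝ) (Ω : ℝ) {z : ι → ℂ} (hz : z ∈ phaseSpace ι)
    (v : ι → ℂ) :
    fderiv ℝ (hamiltonian Γ Ω) z v = symplecticForm Γ (velocity Γ Ω z) v := by
  refine fderiv_apply_eq_of_line
    ((contDiffAt_hamiltonian Γ Ω hz).differentiableAt (by simp)) ?_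
  have hl : ∀ j, ∀ k ∈ univ.erase j, HasDerivAt
      (fun t : ℝ => Γ j * Γ k * Real.log (‖(z + t • v) j - (z + t • v) k‖ ^ 2))
      (Γ j * Γ k * (2 * ((z j - z k).re * (v j - v k).re + (z j - z k).im * (v j - v k).im) /
        ‖z j - z k‖ ^ 2)) 0 := by
    intro j k hk
    have hne := sub_ne_zero_of_mem_phaseSpace hz (ne_of_mem_erase hk)
    have h := hasDerivAt_norm_sq_line ((hasDerivAt_line z v j).sub (hasDerivAt_line z v k))
    have := (h.log (by simpa using hne)).const_mul (Γ j * Γ k)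
    simpa using this
  have h := ((hasDerivAt_momentum_line Γ z v).const_mul Ω).add
    (((HasDerivAt.fun_sum fun j (_ : j ∈ univ) => HasDerivAt.fun_sum (hl j)).const_mul
      (1 / 2 : ℝ)).const_mul (1 / (4 * Real.pi)))
  refine h.congr_deriv ?_
  -- symmetrise the double sum
  set c : ι → ι → ℝ := fun j k => Γ j * Γ k *
    (((z j - z k).re * (v j).re + (z j - z k).im * (v j).im) / ‖z j - z k‖ ^ 2) with hc
  have hsym : ∑ j, ∑ k ∈ univ.erase j, Γ j * Γ k *
      (2 * ((z j - z k).re * (v j - v k).re + (z j - z k).im * (v j - v k).im) /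
        ‖z j - z k‖ ^ 2) = 4 * ∑ j, ∑ k ∈ univ.erase j, c j k := by
    have h1 : ∑ j, ∑ k ∈ univ.erase j, Γ j * Γ k *
      (2 * ((z j - z k).re * (v j - v k).re + (z j - z k).im * (v j - v k).im) /
        ‖z j - z k‖ ^ 2) = ∑ j, ∑ k ∈ univ.erase j, (2 * c j k + 2 * c k j) := by
      refine Finset.sum_congr rfl fun j _ => Finset.sum_congr rfl fun k _ => ?_
      simp only [hc]
      rw [norm_sub_rev (z k) (z j)]
      simp only [Complex.sub_re, Complex.sub_im]
      ring
    rw [h1]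
    simp only [Finset.sum_add_distrib, ← Finset.mul_sum]
    rw [sum_sum_erase_comm fun j k => c k j]
    ring
  rw [hsym, symplecticForm, Finset.mul_sum, Finset.mul_sum, Finset.mul_sum, Finset.mul_sum,
    ← Finset.sum_add_distrib]
  symm
  refine Finset.sum_congr rfl fun j _ => ?_
  have hX : velocity Γ Ω z j = Complex.I * ((Ω : ℂ) * z j + ((1 / (2 * Real.pi) : ℝ) : ℂ) *
      ∑ k ∈ univ.erase j, ((Γ k / ‖z j - z k‖ ^ 2 : ℝ) : ℂ) * (z j - z k)) := by
    rw [velocity, mul_add, mul_assoc, map_mul, map_sum]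
    congr 1
    have h1 : (starRingEnd ℂ) (1 / (2 * (Real.pi : ℂ) * Complex.I)) =
        Complex.I * ((1 / (2 * Real.pi) : ℝ) : ℂ) := by
      have : (Real.pi : ℂ) ≠ 0 := by exact_mod_cast Real.pi_ne_zero
      rw [map_div₀, map_one, map_mul, map_mul, Complex.conj_I, Complex.conj_ofReal, map_ofNat]
      push_cast
      field_simp
      simp
    rw [h1, mul_assoc]
    congr 2
    refine Finset.sum_congr rfl fun k hk => ?_
    have hne := sub_ne_zero_of_mem_phaseSpace hz (ne_of_mem_erase hk)
    rw [map_div₀, Complex.conj_ofReal]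
    have hn := Complex.mul_conj' (z j - z k)
    have hc' : (starRingEnd ℂ) (z j - z k) ≠ 0 := (map_ne_zero _).2 hne
    push_cast
    rw [← hn]
    field_simp
  rw [hX]
  simp only [Complex.mul_im, Complex.mul_re, Complex.I_re, Complex.I_im, Complex.add_re,
    Complex.add_im, Complex.ofReal_re, Complex.ofReal_im, Complex.re_sum, Complex.im_sum]
  have hcj : ∑ k ∈ univ.erase j, c j k = Γ j * ((v j).re *
      ∑ k ∈ univ.erase j, (Γ k / ‖z j - z k‖ ^ 2 * (z j - z k).re) + (v j).im *
      ∑ k ∈ univ.erase j, (Γ k / ‖z j - z k‖ ^ 2 * (z j - z k).im)) := by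
    rw [Finset.mul_sum, Finset.mul_sum, ← Finset.sum_add_distrib, Finset.mul_sum]
    refine Finset.sum_congr rfl fun k _ => ?_
    simp only [hc]
    ring
  rw [hcj]
  simp only [zero_mul, add_zero, sub_zero, one_mul, zero_add, zero_sub]
  ring

/-- The symplectic form as a continuous bilinear map. -/
noncomputable def symplecticCLM (Γ : ι → ℝ) : (ι → ℂ) →L[ℝ] (ι → ℂ) →L[ℝ] ℝ :=
  LinearMap.toContinuousLinearMap
    ((LinearMap.toContinuousLinearMap (𝕜 := ℝ) (E := ι → ℂ) (F' := ℝ)).toLinearMap ∘ₗ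
      LinearMap.mk₂ ℝ (symplecticForm Γ)
        (fun u u' v => by
          simp only [symplecticForm, ← Finset.sum_add_distrib]
          exact Finset.sum_congr rfl fun j _ => by simp; ring)
        (fun c u v => by
          simp only [symplecticForm, Finset.smul_sum]
          exact Finset.sum_congr rfl fun j _ => by simp; ring)
        (fun u v v' => by
          simp only [symplecticForm, ← Finset.sum_add_distrib]
          exact Finset.sum_congr rfl fun j _ => by simp; ring)
        (fun c u v => by
          simp only [symplecticForm, Finset.smul_sum]
          exact Finset.sum_congr rfl fun j _ => by simp; ring))

omit [DecidableEq ι] in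
@[simp] lemma symplecticCLM_apply (Γ : ι → ℝ) (u v : ι → ℂ) :
    symplecticCLM Γ u v = symplecticForm Γ u v := rfl

lemma fderiv_hamiltonian_eventuallyEq (Γ : ι → ℝ) (Ω : ℝ) {x : ι → ℂ} (hx : x ∈ phaseSpace ι) :
    fderiv ℝ (hamiltonian Γ Ω) =ᶠ[𝓝 x] fun z => symplecticCLM Γ (velocity Γ Ω z) := by
  filter_upwards [isOpen_phaseSpace.mem_nhds hx] with z hz
  ext v
  exact fderiv_hamiltonian_apply Γ Ω hz v

lemma hasFDerivAt_fderiv_hamiltonian (Γ : ι → ℝ) (Ω : ℝ) {x : ι → ℂ} (hx : x ∈ phaseSpace ι) :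
    HasFDerivAt (fderiv ℝ (hamiltonian Γ Ω))
      ((symplecticCLM Γ).comp (fderiv ℝ (velocity Γ Ω) x)) x :=
  ((symplecticCLM Γ).hasFDerivAt.comp x
    ((contDiffAt_velocity Γ Ω hx).differentiableAt (by simp)).hasFDerivAt).congr_of_eventuallyEq
    (fderiv_hamiltonian_eventuallyEq Γ Ω hx)

/-- The second derivative of `H - ξ J` is `ω (DX (x) ·, ·)`, where `X` is the vector field of the
motion on a plane that rotates with angular velocity `Ω - ξ`. -/
lemma hessian_eq (Γ : ι → ℝ) (Ω ξ : ℝ) {x : ι → ℂ} (hx : x ∈ phaseSpace ι) (u v : ι → ℂ) :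
    hessian Γ Ω ξ x u v = symplecticForm Γ (fderiv ℝ (velocity Γ (Ω - ξ)) x u) v := by
  rw [hessian, augmentedHamiltonian_eq, (hasFDerivAt_fderiv_hamiltonian Γ (Ω - ξ) hx).fderiv]
  rfl

/-! ### Rotations and conserved quantities -/

omit [Fintype ι] [DecidableEq ι] in
lemma norm_rotate_apply (θ : ℝ) (z : ι → ℂ) (j : ι) : ‖rotate θ z j‖ = ‖z j‖ := by
  rw [rotate, norm_mul, Complex.norm_exp_ofReal_mul_I, one_mul]

omit [Fintype ι] [DecidableEq ι] in
lemma rotate_add (θ φ : ℝ) (z : ι → ℂ) : rotate (θ + φ) z = rotate θ (rotate φ z) := by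
  funext j
  simp only [rotate]
  rw [← mul_assoc, ← Complex.exp_add]
  push_cast
  ring_nf

omit [Fintype ι] [DecidableEq ι] in
lemma rotate_zero (z : ι → ℂ) : rotate 0 z = z := by
  funext j; simp [rotate]

omit [Fintype ι] [DecidableEq ι] in
lemma rotate_mem_phaseSpace {z : ι → ℂ} (hz : z ∈ phaseSpace ι) (θ : ℝ) :
    rotate θ z ∈ phaseSpace ι := fun _ _ h => hz (mul_left_cancel₀ (Complex.exp_ne_zero _) h)

lemma hamiltonian_rotate (Γ : ι → ℝ) (Ω θ : ℝ) (z : ι → ℂ) :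
    hamiltonian Γ Ω (rotate θ z) = hamiltonian Γ Ω z := by
  have h : ∀ j k, ‖rotate θ z j - rotate θ z k‖ = ‖z j - z k‖ := by
    intro j k
    rw [rotate, rotate, ← mul_sub, norm_mul, Complex.norm_exp_ofReal_mul_I, one_mul]
  simp only [hamiltonian, momentum, norm_rotate_apply, h]

omit [Fintype ι] [DecidableEq ι] in
lemma hasDerivAt_exp_mul_I (ξ t : ℝ) :
    HasDerivAt (fun s : ℝ => Complex.exp (((ξ * s : ℝ) : ℂ) * Complex.I))
      (Complex.I * ξ * Complex.exp (((ξ * t : ℝ) : ℂ) * Complex.I)) t := by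
  have h1 : HasDerivAt (fun s : ℝ => ((ξ * s : ℝ) : ℂ) * Complex.I) (ξ * Complex.I) t := by
    have := (((hasDerivAt_id t).const_mul ξ).ofReal_comp).mul_const Complex.I
    simpa using this
  convert h1.cexp using 1
  ring

omit [Fintype ι] [DecidableEq ι] in
lemma hasDerivAt_rotate (ξ : ℝ) (z : ι → ℂ) (t : ℝ) :
    HasDerivAt (fun s : ℝ => rotate (ξ * s) z)
      (fun j => Complex.I * ξ * rotate (ξ * t) z j) t := by
  refine hasDerivAt_pi.2 fun j => ?_
  have := (hasDerivAt_exp_mul_I ξ t).mul_const (z j)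
  refine this.congr_deriv ?_
  simp only [rotate]
  ring

lemma velocity_rotate (Γ : ι → ℝ) (Ω θ : ℝ) (z : ι → ℂ) :
    velocity Γ Ω (rotate θ z) = rotate θ (velocity Γ Ω z) := by
  funext j
  simp only [velocity, rotate]
  set e := Complex.exp ((θ : ℂ) * Complex.I) with he
  have hne : e ≠ 0 := Complex.exp_ne_zero _
  have hc : (starRingEnd ℂ) e = e⁻¹ := by
    rw [Complex.inv_eq_conj (Complex.norm_exp_ofReal_mul_I θ)]
  have hs : ∑ k ∈ univ.erase j, (Γ k : ℂ) / (e * z j - e * z k) =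
      e⁻¹ * ∑ k ∈ univ.erase j, (Γ k : ℂ) / (z j - z k) := by
    rw [Finset.mul_sum]
    refine Finset.sum_congr rfl fun k _ => ?_
    rw [← mul_sub, div_mul_eq_div_div, div_right_comm, div_eq_inv_mul]
  rw [hs, mul_left_comm _ e⁻¹, map_mul (starRingEnd ℂ) e⁻¹, map_inv₀, hc, inv_inv]
  ring

lemma symplecticForm_velocity_I_mul (Γ : ι → ℝ) (Ω : ℝ) {z : ι → ℂ} (hz : z ∈ phaseSpace ι) :
    symplecticForm Γ (velocity Γ Ω z) (fun j => Complex.I * z j) = 0 := by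
  rw [← fderiv_hamiltonian_apply Γ Ω hz]
  have h1 : HasDerivAt (fun s : ℝ => rotate (1 * s) z) (fun j => Complex.I * z j) 0 := by
    simpa [rotate_zero] using hasDerivAt_rotate 1 z 0
  have h2 : HasFDerivAt (hamiltonian Γ Ω) (fderiv ℝ (hamiltonian Γ Ω) z) (rotate (1 * 0) z) := by
    rw [mul_zero, rotate_zero]
    exact ((contDiffAt_hamiltonian Γ Ω hz).differentiableAt (by simp)).hasFDerivAt
  have h3 := h2.comp_hasDerivAt (0 : ℝ) h1
  have h4 : (hamiltonian Γ Ω ∘ fun s : ℝ => rotate (1 * s) z) = fun _ => hamiltonian Γ Ω z := by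
    funext s; exact hamiltonian_rotate Γ Ω _ z
  rw [h4] at h3
  exact h3.unique (hasDerivAt_const _ _)

/-- The Hamiltonian on a plane that rotates with any angular velocity `Ω'` is conserved by the
motion on a plane that rotates with another angular velocity `Ω`. -/
lemma fderiv_hamiltonian_velocity (Γ : ι → ℝ) (Ω Ω' : ℝ) {z : ι → ℂ} (hz : z ∈ phaseSpace ι) :
    fderiv ℝ (hamiltonian Γ Ω') z (velocity Γ Ω z) = 0 := by
  have h1 : velocity Γ Ω z = velocity Γ Ω' z + (Ω - Ω') • fun j => Complex.I * z j := by
    funext j; simp [velocity]; ring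
  rw [fderiv_hamiltonian_apply Γ Ω' hz, ← symplecticCLM_apply]
  rw [h1, map_add, map_smul, symplecticCLM_apply, symplecticCLM_apply,
    symplecticForm_velocity_I_mul Γ Ω' hz, smul_zero, add_zero]
  exact Finset.sum_eq_zero fun j _ => by ring

end Calculus

/-! ### The linearization at the ring with a central vortex -/

/-- The angular velocity `1 / (4 π R ^ 2)`, the common scale of all frequencies of the ring. -/
noncomputable def frequency (R : ℝ) : ℝ := 1 / (4 * Real.pi * R ^ 2)

/-- The relative equilibrium rotates with angular velocity `Ω + frequency R * diagCoeff N l`. In the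
corotating frame this gives the part of the linearization that is diagonal in the Fourier modes. -/
noncomputable def diagCoeff (N : ℕ) (l : ℝ) : ℝ := N - 1 + 2 * l

/-- The coupling, in units of `frequency R`, of the Fourier modes of index `k` and `-k`. -/
noncomputable def pairCoeff (N : ℕ) (l : ℝ) (k : ℕ) : ℝ := ((k : ℝ) - 1) * (N - k - 1) - 2 * l

/-- The linearization at the ring of the motion in the corotating frame. -/
noncomputable def linearization (N : ℕ) (l R : ℝ) :
    (Option (Fin N) → ℂ) →L[ℝ] (Option (Fin N) → ℂ) :=
  fderiv ℝ (velocity (ringStrength N l) (-(frequency R * diagCoeff N l))) (ringWithCentre N R)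

lemma frequency_pos (hR : 0 < R) : 0 < frequency R := by unfold frequency; positivity

lemma sub_ringAngularVelocity (Ω : ℝ) :
    Ω - ringAngularVelocity N l R Ω = -(frequency R * diagCoeff N l) := by
  unfold ringAngularVelocity frequency diagCoeff
  ring

lemma ringWithCentre_some (j : Fin N) : ringWithCentre N R (some j) = R * vertex N j := rfl

lemma ringWithCentre_none : ringWithCentre N R none = 0 := rfl

lemma ringWithCentre_mem_phaseSpace (hR : 0 < R) :
    ringWithCentre N R ∈ phaseSpace (Option (Fin N)) := by
  have hR' : (R : ℂ) ≠ 0 := by exact_mod_cast hR.ne'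
  rintro (_ | j) (_ | k) h
  · rfl
  · exact absurd h.symm (mul_ne_zero hR' (vertex_ne_zero k))
  · exact absurd h (mul_ne_zero hR' (vertex_ne_zero j))
  · exact congrArg some (vertex_injective (mul_left_cancel₀ hR' h))

lemma sum_erase_some {M : Type*} [AddCommGroup M] (f : Option (Fin N) → M) (j : Fin N) :
    ∑ k ∈ univ.erase (some j), f k = f none + ∑ k ∈ univ.erase j, f (some k) := by
  rw [Finset.sum_erase_eq_sub (mem_univ _), Finset.sum_erase_eq_sub (mem_univ _),
    Fintype.sum_option]
  abel

lemma sum_erase_none {M : Type*} [AddCommGroup M] (f : Option (Fin N) → M) :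
    ∑ k ∈ univ.erase none, f k = ∑ k, f (some k) := by
  rw [Finset.sum_erase_eq_sub (mem_univ _), Fintype.sum_option]
  abel

lemma conj_one_div_mul (hR : 0 < R) (S : ℂ) :
    (starRingEnd ℂ) (1 / (2 * (Real.pi : ℂ) * Complex.I) * (S / (R : ℂ) ^ 2)) =
      2 * Complex.I * frequency R * (starRingEnd ℂ) S := by
  have hR' : (R : ℂ) ≠ 0 := by exact_mod_cast hR.ne'
  have hp : (Real.pi : ℂ) ≠ 0 := by exact_mod_cast Real.pi_ne_zero
  rw [map_mul, map_div₀, map_div₀, map_one, map_mul, map_mul, Complex.conj_I, map_pow,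
    Complex.conj_ofReal, Complex.conj_ofReal, map_ofNat, frequency]
  push_cast
  field_simp
  rw [Complex.I_sq]
  ring

lemma dvd_two_sub_iff {n : ℤ} (hN : 3 ≤ N) (h1 : -2 ≤ n) (h2 : n ≤ 2) :
    (N : ℤ) ∣ n ↔ n = 0 := by
  refine ⟨fun h => ?_, fun h => h ▸ dvd_zero _⟩
  exact Int.eq_zero_of_abs_lt_dvd h (by rw [abs_lt]; omega)

lemma sum_vertex_zpow_eq_zero {n : ℤ} (hN : 3 ≤ N) (h1 : -2 ≤ n) (h2 : n ≤ 2) (h0 : n ≠ 0) :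
    ∑ j : Fin N, vertex N j ^ n = 0 := by
  rw [sum_vertex_zpow, if_neg (mt (dvd_two_sub_iff hN h1 h2).1 h0)]

lemma velocity_ring (hN : 3 ≤ N) (hR : 0 < R) (Ω : ℝ) :
    velocity (ringStrength N l) Ω (ringWithCentre N R) =
      fun j => Complex.I * (ringAngularVelocity N l R Ω : ℝ) * ringWithCentre N R j := by
  have hR' : (R : ℂ) ≠ 0 := by exact_mod_cast hR.ne'
  have hξ : ((ringAngularVelocity N l R Ω : ℝ) : ℂ) =
      Ω + frequency R * ((N : ℂ) - 1 + 2 * l) := by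
    unfold ringAngularVelocity frequency; push_cast; ring
  funext o
  rcases o with _ | j
  · rw [velocity, sum_erase_none, ringWithCentre_none]
    have : ∑ k : Fin N, (ringStrength N l (some k) : ℂ) / (0 - ringWithCentre N R (some k)) =
        -(1 / (R : ℂ)) * ∑ k : Fin N, vertex N k ^ (-1 : ℤ) := by
      rw [Finset.mul_sum]
      refine Finset.sum_congr rfl fun k _ => ?_
      rw [ringWithCentre_some, zpow_neg_one]
      have := vertex_ne_zero k
      simp [ringStrength]
      ring
    rw [this, sum_vertex_zpow_eq_zero hN (by norm_num) (by norm_num) (by norm_num)]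
    simp
  · have h0 := vertex_ne_zero j
    have hs : ∑ k ∈ univ.erase (some j), (ringStrength N l k : ℂ) /
        (ringWithCentre N R (some j) - ringWithCentre N R k) =
        (R * (vertex N j)⁻¹ * (((N : ℂ) - 1) / 2 + l)) / (R : ℂ) ^ 2 := by
      have h1 : ∑ k ∈ univ.erase j, (ringStrength N l (some k) : ℂ) /
          (ringWithCentre N R (some j) - ringWithCentre N R (some k)) =
          1 / (R : ℂ) * firstSum N 0 j := by
        rw [firstSum, Finset.mul_sum]
        refine Finset.sum_congr rfl fun k hk => ?_
        have := vertex_sub_ne_zero hk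
        rw [ringWithCentre_some, ringWithCentre_some, ← mul_sub]
        simp [ringStrength]
        ring
      rw [sum_erase_some, h1, ← vertex_mul_firstSum_zero j, ringWithCentre_none,
        ringWithCentre_some, ringStrength]
      field_simp
      ring
    rw [velocity, hs, conj_one_div_mul hR, map_mul, map_mul, map_inv₀, conj_vertex, inv_inv,
      Complex.conj_ofReal, hξ, ringWithCentre_some]
    simp only [map_add, map_div₀, map_sub, map_natCast, map_one, map_ofNat, Complex.conj_ofReal]
    ring

theorem isRelativeEquilibrium_ring (hN : 3 ≤ N) (hR : 0 < R) (Ω : ℝ) :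
    IsRelativeEquilibrium (ringStrength N l) Ω (ringWithCentre N R)
      (ringAngularVelocity N l R Ω) := by
  intro t _
  refine ⟨rotate_mem_phaseSpace (ringWithCentre_mem_phaseSpace hR) _, ?_⟩
  refine ((hasDerivAt_rotate (ringAngularVelocity N l R Ω) (ringWithCentre N R)
    t).congr_deriv ?_).hasDerivWithinAt
  rw [velocity_rotate, velocity_ring hN hR]
  funext j
  simp only [rotate]
  ring

lemma linearization_some (hR : 0 < R) (u : Option (Fin N) → ℂ) (j : Fin N) :
    linearization N l R u (some j) =
      -(Complex.I * frequency R * diagCoeff N l) * u (some j) -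
        2 * Complex.I * frequency R * (starRingEnd ℂ)
          (∑ k ∈ univ.erase j, (u (some j) - u (some k)) / (vertex N j - vertex N k) ^ 2 +
            l * (u (some j) - u none) * vertex N j ^ (-2 : ℤ)) := by
  have hR' : (R : ℂ) ≠ 0 := by exact_mod_cast hR.ne'
  have h0 := vertex_ne_zero j
  have hs : ∑ k ∈ univ.erase (some j), (ringStrength N l k : ℂ) *
      ((u (some j) - u k) / (ringWithCentre N R (some j) - ringWithCentre N R k) ^ 2) =
      (∑ k ∈ univ.erase j, (u (some j) - u (some k)) / (vertex N j - vertex N k) ^ 2 +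
            l * (u (some j) - u none) * vertex N j ^ (-2 : ℤ)) / (R : ℂ) ^ 2 := by
    rw [sum_erase_some, add_comm, add_div, Finset.sum_div]
    congr 1
    · refine Finset.sum_congr rfl fun k hk => ?_
      rw [ringWithCentre_some, ringWithCentre_some, ← mul_sub, mul_pow, div_div,
        mul_comm ((R : ℂ) ^ 2)]
      simp [ringStrength]
    · rw [ringWithCentre_some, ringWithCentre_none, zpow_neg]
      simp only [ringStrength, sub_zero]
      field_simp
  rw [linearization, fderiv_velocity_apply _ _ (ringWithCentre_mem_phaseSpace hR), hs,
    conj_one_div_mul hR]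
  push_cast
  ring

lemma linearization_none (hN : 3 ≤ N) (hR : 0 < R) (u : Option (Fin N) → ℂ) :
    linearization N l R u none =
      -(Complex.I * frequency R * diagCoeff N l) * u none +
        2 * Complex.I * frequency R * (starRingEnd ℂ) (coeff 1 fun j => u (some j)) := by
  have hR' : (R : ℂ) ≠ 0 := by exact_mod_cast hR.ne'
  have hs : ∑ k ∈ univ.erase none, (ringStrength N l k : ℂ) *
      ((u none - u k) / (ringWithCentre N R none - ringWithCentre N R k) ^ 2) =
      -(coeff 1 fun j => u (some j)) / (R : ℂ) ^ 2 := by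
    have h1 : -(coeff 1 fun j => u (some j)) =
        u none * ∑ j : Fin N, vertex N j ^ (-2 : ℤ) - coeff 1 fun j => u (some j) := by
      rw [sum_vertex_zpow_eq_zero hN (by norm_num) (by norm_num) (by norm_num)]; simp
    rw [h1, coeff, Finset.mul_sum, ← Finset.sum_sub_distrib, Finset.sum_div, sum_erase_none]
    refine Finset.sum_congr rfl fun k _ => ?_
    have h0 := vertex_ne_zero k
    rw [ringWithCentre_some, ringWithCentre_none]
    simp only [ringStrength]
    norm_num
    field_simp
  rw [linearization, fderiv_velocity_apply _ _ (ringWithCentre_mem_phaseSpace hR), hs,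
    conj_one_div_mul hR, map_neg]
  push_cast
  ring

/-- The linearization in Fourier coefficients: the index `k` is coupled to `-k`, and for `k = 1`
also to the central vortex. -/
lemma coeff_linearization (hR : 0 < R) (u : Option (Fin N) → ℂ) {k : ℕ} (hk : k ≤ N) :
    coeff k (fun j => linearization N l R u (some j)) =
      -(Complex.I * frequency R * diagCoeff N l) * coeff k (fun j => u (some j)) +
        Complex.I * frequency R * pairCoeff N l k *
          (starRingEnd ℂ) (coeff (-k) fun j => u (some j)) +
        2 * Complex.I * frequency R * l * (if (N : ℤ) ∣ (k : ℤ) - 1 then (N : ℂ) else 0) *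
          (starRingEnd ℂ) (u none) := by
  set T : Fin N → ℂ := fun j =>
    ∑ m ∈ univ.erase j, (u (some j) - u (some m)) / (vertex N j - vertex N m) ^ 2 +
      l * (u (some j) - u none) * vertex N j ^ (-2 : ℤ) with hT
  have h1 : coeff k (fun j => linearization N l R u (some j)) =
      -(Complex.I * frequency R * diagCoeff N l) * coeff k (fun j => u (some j)) -
        2 * Complex.I * frequency R *
          (starRingEnd ℂ) (∑ j, vertex N j ^ ((k : ℤ) + 1) * T j) := by
    simp only [coeff]
    rw [map_sum, Finset.mul_sum, Finset.mul_sum, ← Finset.sum_sub_distrib]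
    refine Finset.sum_congr rfl fun j _ => ?_
    rw [linearization_some hR, map_mul, map_zpow₀, conj_vertex, inv_zpow, ← zpow_neg]
    ring
  have h2 : ∑ j, vertex N j ^ ((k : ℤ) + 1) *
      ∑ m ∈ univ.erase j, (u (some j) - u (some m)) / (vertex N j - vertex N m) ^ 2 =
      -((k - 1) * (N - k - 1) / 2) * coeff (-k) fun j => u (some j) := by
    have e : ∀ j, vertex N j ^ ((k : ℤ) + 1) *
        ∑ m ∈ univ.erase j, (u (some j) - u (some m)) / (vertex N j - vertex N m) ^ 2 =
        ∑ m ∈ univ.erase j,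
          u (some j) * (vertex N j ^ ((k : ℤ) + 1) / (vertex N j - vertex N m) ^ 2) -
        ∑ m ∈ univ.erase j,
          vertex N j ^ ((k : ℤ) + 1) * u (some m) / (vertex N j - vertex N m) ^ 2 := by
      intro j
      rw [Finset.mul_sum, ← Finset.sum_sub_distrib]
      exact Finset.sum_congr rfl fun m _ => by ring
    rw [Finset.sum_congr rfl fun j _ => e j, Finset.sum_sub_distrib,
      sum_sum_erase_comm fun j m =>
        vertex N j ^ ((k : ℤ) + 1) * u (some m) / (vertex N j - vertex N m) ^ 2,
      ← Finset.sum_sub_distrib, coeff, Finset.mul_sum]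
    refine Finset.sum_congr rfl fun j _ => ?_
    have hs := secondSum_succ_eq j hk
    rw [show (-(-(k : ℤ) + 1)) = (k : ℤ) - 1 by ring, ← mul_assoc, ← hs, secondSum,
      Finset.sum_mul, ← Finset.sum_sub_distrib]
    refine Finset.sum_congr rfl fun m _ => ?_
    rw [← neg_sub (vertex N j) (vertex N m), neg_sq]
    norm_cast
    ring
  have h3 : ∑ j, vertex N j ^ ((k : ℤ) + 1) *
      (l * (u (some j) - u none) * vertex N j ^ (-2 : ℤ)) =
      l * ((coeff (-k) fun j => u (some j)) -
        (if (N : ℤ) ∣ (k : ℤ) - 1 then (N : ℂ) else 0) * u none) := by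
    rw [← sum_vertex_zpow, coeff, Finset.sum_mul, ← Finset.sum_sub_distrib, Finset.mul_sum]
    refine Finset.sum_congr rfl fun j _ => ?_
    have hz : vertex N j ^ ((k : ℤ) - 1) = vertex N j ^ ((k : ℤ) + 1) * vertex N j ^ (-2 : ℤ) := by
      rw [← zpow_add₀ (vertex_ne_zero j)]; congr 1; ring
    rw [show (-(-(k : ℤ) + 1)) = (k : ℤ) - 1 by ring, hz]
    ring
  rw [h1]
  simp only [hT, mul_add, Finset.sum_add_distrib]
  rw [h2, h3]
  have hif : (starRingEnd ℂ) (if (N : ℤ) ∣ (k : ℤ) - 1 then (N : ℂ) else 0) =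
      if (N : ℤ) ∣ (k : ℤ) - 1 then (N : ℂ) else 0 := by split_ifs <;> simp
  simp only [map_add, map_mul, map_neg, map_sub, map_div₀, map_natCast, map_one, map_ofNat,
    Complex.conj_ofReal, hif, pairCoeff]
  push_cast
  ring

lemma mem_slice_iff (hR : 0 < R) (v : Option (Fin N) → ℂ) :
    v ∈ slice (ringStrength N l) (ringWithCentre N R) ↔ coeff 0 (fun j => v (some j)) = 0 := by
  have h1 : fderiv ℝ (momentum (ringStrength N l)) (ringWithCentre N R) v =
      R * (coeff 0 fun j => v (some j)).re := by
    rw [fderiv_momentum_apply, Fintype.sum_option, coeff, Complex.re_sum, Finset.mul_sum]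
    simp only [ringWithCentre_none, ringWithCentre_some, ringStrength]
    rw [Complex.zero_re, Complex.zero_im, zero_mul, zero_mul, add_zero, mul_zero, zero_add]
    refine Finset.sum_congr rfl fun j _ => ?_
    rw [show (-((0 : ℤ) + 1)) = -1 by rfl, zpow_neg_one, ← conj_vertex]
    simp
    ring
  have h2 : ∑ j, ((Complex.I * ringWithCentre N R j).re * (v j).re +
      (Complex.I * ringWithCentre N R j).im * (v j).im) =
      R * (coeff 0 fun j => v (some j)).im := by
    rw [Fintype.sum_option, coeff, Complex.im_sum, Finset.mul_sum]
    simp only [ringWithCentre_none, ringWithCentre_some]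
    rw [mul_zero, Complex.zero_re, Complex.zero_im, zero_mul, zero_mul, add_zero, zero_add]
    refine Finset.sum_congr rfl fun j _ => ?_
    rw [show (-((0 : ℤ) + 1)) = -1 by rfl, zpow_neg_one, ← conj_vertex]
    simp
    ring
  change (fderiv ℝ (momentum (ringStrength N l)) (ringWithCentre N R) v = 0 ∧ _ = 0) ↔ _
  rw [h1, h2, Complex.ext_iff]
  simp [hR.ne']

lemma linearization_mem_slice (hN : 3 ≤ N) (hR : 0 < R) {v : Option (Fin N) → ℂ}
    (hv : v ∈ slice (ringStrength N l) (ringWithCentre N R)) :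
    linearization N l R v ∈ slice (ringStrength N l) (ringWithCentre N R) := by
  rw [mem_slice_iff hR] at hv ⊢
  have h := coeff_linearization (l := l) hR v (k := 0) (by omega)
  have hd : ¬ (N : ℤ) ∣ ((0 : ℕ) : ℤ) - 1 := by
    rw [dvd_two_sub_iff hN] <;> simp
  rw [if_neg hd] at h
  simp only [Nat.cast_zero, neg_zero] at h
  rw [h, hv]
  simp

/-- The restriction of the linearization to the symplectic slice. -/
noncomputable def sliceLinearization (hN : 3 ≤ N) (hR : 0 < R) (l : ℝ) :
    Module.End ℝ (slice (ringStrength N l) (ringWithCentre N R)) :=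
  (linearization N l R).toLinearMap.restrict fun _ hv => linearization_mem_slice hN hR hv

lemma coe_sliceLinearization (hN : 3 ≤ N) (hR : 0 < R)
    (v : slice (ringStrength N l) (ringWithCentre N R)) :
    (sliceLinearization hN hR l v : Option (Fin N) → ℂ) = linearization N l R v := rfl

lemma hessian_ring (hR : 0 < R) (Ω : ℝ) (u v : Option (Fin N) → ℂ) :
    hessian (ringStrength N l) Ω (ringAngularVelocity N l R Ω) (ringWithCentre N R) u v =
      symplecticForm (ringStrength N l) (linearization N l R u) v := by
  rw [hessian_eq _ _ _ (ringWithCentre_mem_phaseSpace hR), sub_ringAngularVelocity, linearization]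

lemma isSliceLinearization_sliceLinearization (hN : 3 ≤ N) (hR : 0 < R) (l Ω : ℝ) :
    IsSliceLinearization (ringStrength N l) Ω (ringAngularVelocity N l R Ω)
      (ringWithCentre N R) (sliceLinearization hN hR l) := by
  intro u v
  rw [hessian_ring hR, coe_sliceLinearization]

/-! ### Fourier modes -/

/-- The displacement `a E_j ^ n` of the ring, with the central vortex at rest. -/
noncomputable def mode (N : ℕ) (n : ℤ) (a : ℂ) : Option (Fin N) → ℂ
  | none => 0
  | some j => a * vertex N j ^ n

/-- The displacement `c` of the central vortex, with the ring at rest. -/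
def centre (N : ℕ) (c : ℂ) : Option (Fin N) → ℂ
  | none => c
  | some _ => 0

lemma coeff_mode (m n : ℤ) (a : ℂ) :
    coeff m (fun j => mode N n a (some j)) =
      a * if (N : ℤ) ∣ n - (m + 1) then (N : ℂ) else 0 := by
  rw [← sum_vertex_zpow, coeff, Finset.mul_sum]
  refine Finset.sum_congr rfl fun j _ => ?_
  rw [mode, sub_eq_add_neg, zpow_add₀ (vertex_ne_zero j)]
  ring

lemma mode_congr {m n : ℤ} (h : (N : ℤ) ∣ m - n) (a : ℂ) : mode N m a = mode N n a := by
  funext o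
  rcases o with _ | j
  · rfl
  · rw [mode, mode, vertex_zpow_eq_of_dvd h]

lemma mode_add (n : ℤ) (a b : ℂ) : mode N n (a + b) = mode N n a + mode N n b := by
  funext o
  rcases o with _ | j <;> simp [mode, add_mul]

lemma smul_mode (n : ℤ) (r : ℝ) (a : ℂ) : r • mode N n a = mode N n (r * a) := by
  funext o
  rcases o with _ | j <;> simp [mode, mul_assoc]

lemma smul_centre (r : ℝ) (a : ℂ) : r • centre N a = centre N (r * a) := by
  funext o
  rcases o with _ | j <;> simp [centre]

lemma linearization_mode (hN : 3 ≤ N) (hR : 0 < R) {k : ℕ} (hk : k ≤ N) (a : ℂ) :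
    linearization N l R (mode N (k + 1) a) =
      mode N (k + 1) (-(Complex.I * frequency R * diagCoeff N l) * a) +
      mode N (1 - k) (Complex.I * frequency R * pairCoeff N l k * (starRingEnd ℂ) a) +
      centre N (2 * Complex.I * frequency R * (starRingEnd ℂ) a *
        if (N : ℤ) ∣ (k : ℤ) - 1 then (N : ℂ) else 0) := by
  funext o
  rcases o with _ | j
  · rw [linearization_none hN hR, coeff_mode]
    have hif : (starRingEnd ℂ) (if (N : ℤ) ∣ (k : ℤ) - 1 then (N : ℂ) else 0) =
      if (N : ℤ) ∣ (k : ℤ) - 1 then (N : ℂ) else 0 := by split_ifs <;> simp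
    rw [show (k : ℤ) + 1 - (1 + 1) = k - 1 by ring, map_mul, hif]
    simp only [Pi.add_apply, mode, centre, mul_zero, zero_add]
    ring
  · have hs := secondSum_succ_eq j hk
    have h1 : ∑ m ∈ univ.erase j, (mode N (k + 1) a (some j) - mode N (k + 1) a (some m)) /
        (vertex N j - vertex N m) ^ 2 = a * secondSum N (k + 1) j := by
      rw [secondSum, Finset.mul_sum]
      refine Finset.sum_congr rfl fun m _ => ?_
      simp only [mode]
      norm_cast
      ring
    have hz : vertex N j ^ ((k : ℤ) + 1) * vertex N j ^ (-2 : ℤ) = vertex N j ^ ((k : ℤ) - 1) := by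
      rw [← zpow_add₀ (vertex_ne_zero j)]; congr 1; ring
    have h2 : l * (mode N (k + 1) a (some j) - mode N (k + 1) a none) * vertex N j ^ (-2 : ℤ) =
        l * a * vertex N j ^ ((k : ℤ) - 1) := by
      rw [← hz]; simp only [mode]; ring
    have hc : (starRingEnd ℂ) (vertex N j ^ ((k : ℤ) - 1)) = vertex N j ^ (1 - (k : ℤ)) := by
      rw [map_zpow₀, conj_vertex, inv_zpow, ← zpow_neg, neg_sub]
    rw [linearization_some hR, h1, h2, hs]
    simp only [map_add, map_mul, map_neg, map_sub, map_div₀, map_natCast, map_one, map_ofNat,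
      Complex.conj_ofReal, hc, pairCoeff, Pi.add_apply, mode, centre]
    push_cast
    ring

lemma linearization_centre (hN : 3 ≤ N) (hR : 0 < R) (c : ℂ) :
    linearization N l R (centre N c) =
      centre N (-(Complex.I * frequency R * diagCoeff N l) * c) +
      mode N 2 (2 * Complex.I * frequency R * l * (starRingEnd ℂ) c) := by
  funext o
  rcases o with _ | j
  · rw [linearization_none hN hR]
    simp [centre, mode, coeff]
  · rw [linearization_some hR]
    have hc : (starRingEnd ℂ) (vertex N j ^ (-2 : ℤ)) = vertex N j ^ (2 : ℤ) := by
      rw [map_zpow₀, conj_vertex, inv_zpow, ← zpow_neg, neg_neg]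
    simp only [centre, sub_self, zero_div, Finset.sum_const_zero, zero_add, map_mul,
      Complex.conj_ofReal, hc, Pi.add_apply, mode, zero_sub, map_neg]
    ring

/-! ### The frequencies of the Fourier modes -/

lemma diagCoeff_add_pairCoeff (k : ℕ) : diagCoeff N l + pairCoeff N l k = k * (N - k) := by
  unfold diagCoeff pairCoeff; ring

lemma diagCoeff_sub_pairCoeff (k : ℕ) :
    diagCoeff N l - pairCoeff N l k = 2 * (N - 1) - k * (N - k) + 4 * l := by
  unfold diagCoeff pairCoeff; ring

lemma diagCoeff_sq_sub : diagCoeff N l ^ 2 - 4 * l ^ 2 - 4 * l * N = ((N : ℝ) - 1) ^ 2 - 4 * l := by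
  unfold diagCoeff; ring

lemma pairCoeff_reflect {k : ℕ} (hk : k ≤ N) : pairCoeff N l (N - k) = pairCoeff N l k := by
  unfold pairCoeff
  rw [Nat.cast_sub hk]
  ring

lemma pairCoeff_one : pairCoeff N l 1 = -(2 * l) := by
  unfold pairCoeff; push_cast; ring

/-- Of all pairs of modes, the one with index nearest to `N / 2` is the first to become unstable. -/
lemma diagCoeff_sub_pairCoeff_ge (k : ℕ) :
    4 * (l - lowerThreshold N) ≤ diagCoeff N l - pairCoeff N l k := by
  rw [diagCoeff_sub_pairCoeff, lowerThreshold]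
  split_ifs with h
  · nlinarith [sq_nonneg ((N : ℝ) - 2 * k)]
  · have h1 : (1 : ℤ) ≤ ((N : ℤ) - 2 * k) ^ 2 := by
      have h2 : (N : ℤ) - 2 * k ≠ 0 := fun h0 => h ⟨k, by omega⟩
      have := sq_nonneg ((N : ℤ) - 2 * k)
      have := pow_ne_zero 2 h2
      omega
    have h3 : (1 : ℝ) ≤ ((N : ℝ) - 2 * k) ^ 2 := by exact_mod_cast h1
    nlinarith

lemma diagCoeff_sub_pairCoeff_half :
    diagCoeff N l - pairCoeff N l (N / 2) = 4 * (l - lowerThreshold N) := by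
  rw [diagCoeff_sub_pairCoeff, lowerThreshold]
  split_ifs with h
  · obtain ⟨m, rfl⟩ := h
    rw [show (m + m) / 2 = m by omega]
    push_cast
    ring
  · obtain ⟨m, rfl⟩ := Nat.not_even_iff_odd.1 h
    rw [show (2 * m + 1) / 2 = m by omega]
    push_cast
    ring

/-! ### Criteria for instability -/

/-- The real part of an element of the complexification of a real vector space. -/
noncomputable def tensorRe (V : Type*) [AddCommGroup V] [Module ℝ V] : ℂ ⊗[ℝ] V →ₗ[ℝ] V :=
  (TensorProduct.lid ℝ V).toLinearMap ∘ₗ LinearMap.rTensor V Complex.reLm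

/-- The imaginary part of an element of the complexification of a real vector space. -/
noncomputable def tensorIm (V : Type*) [AddCommGroup V] [Module ℝ V] : ℂ ⊗[ℝ] V →ₗ[ℝ] V :=
  (TensorProduct.lid ℝ V).toLinearMap ∘ₗ LinearMap.rTensor V Complex.imLm

section Complexification

variable {V : Type*} [AddCommGroup V] [Module ℝ V]

@[simp] lemma tensorRe_tmul (c : ℂ) (v : V) : tensorRe V (c ⊗ₜ v) = c.re • v := by
  simp [tensorRe]

@[simp] lemma tensorIm_tmul (c : ℂ) (v : V) : tensorIm V (c ⊗ₜ v) = c.im • v := by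
  simp [tensorIm]

lemma tmul_re_add_tmul_im (w : ℂ ⊗[ℝ] V) :
    (1 : ℂ) ⊗ₜ tensorRe V w + Complex.I ⊗ₜ tensorIm V w = w := by
  induction w using TensorProduct.induction_on with
  | zero => simp
  | tmul c v =>
    rw [tensorRe_tmul, tensorIm_tmul, ← TensorProduct.smul_tmul, ← TensorProduct.smul_tmul,
      ← TensorProduct.add_tmul]
    congr 1
    apply Complex.ext <;> simp
  | add x y hx hy =>
    rw [map_add, map_add, TensorProduct.tmul_add, TensorProduct.tmul_add, add_add_add_comm, hx, hy]

/-- A complex eigenvector of a real endomorphism in terms of its real and imaginary parts. -/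
lemma exists_real_pair_of_hasEigenvalue (L : Module.End ℝ V) {m : ℂ}
    (hm : Module.End.HasEigenvalue (LinearMap.baseChange ℂ L) m) :
    ∃ a b : V, ¬ (a = 0 ∧ b = 0) ∧ L a = m.re • a - m.im • b ∧ L b = m.im • a + m.re • b := by
  obtain ⟨w, hw⟩ := hm.exists_hasEigenvector
  have h1 := hw.apply_eq_smul
  refine ⟨tensorRe V w, tensorIm V w, ?_, ?_, ?_⟩
  · rintro ⟨ha, hb⟩
    apply hw.2
    rw [← tmul_re_add_tmul_im w, ha, hb]
    simp
  · rw [← tmul_re_add_tmul_im w] at h1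
    have := congrArg (tensorRe V) h1
    simpa [LinearMap.baseChange_tmul, smul_add, TensorProduct.smul_tmul', sub_eq_add_neg]
      using this
  · rw [← tmul_re_add_tmul_im w] at h1
    have := congrArg (tensorIm V) h1
    simpa [LinearMap.baseChange_tmul, smul_add, TensorProduct.smul_tmul'] using this

lemma hasEigenvalue_baseChange (L : Module.End ℝ V) {v : V} (hv : v ≠ 0) {s : ℝ}
    (h : L v = s • v) : Module.End.HasEigenvalue (LinearMap.baseChange ℂ L) (s : ℂ) := by
  refine Module.End.hasEigenvalue_of_hasEigenvector (x := (1 : ℂ) ⊗ₜ v)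
    ⟨Module.End.mem_eigenspace_iff.2 ?_, fun h0 => hv ?_⟩
  · rw [LinearMap.baseChange_tmul, h, ← TensorProduct.smul_tmul, TensorProduct.smul_tmul']
    simp
  · simpa using congrArg (tensorRe V) h0

end Complexification

section Unbounded

variable {V : Type*} [NormedAddCommGroup V] [NormedSpace ℝ V]

lemma exists_unbounded_solution_of_eigenvector (L : Module.End ℝ V) {v : V} (hv : v ≠ 0) {s : ℝ}
    (hs : 0 < s) (h : L v = s • v) :
    ∃ u : ℝ → V, (∀ t : ℝ, HasDerivAt u (L (u t)) t) ∧
      ¬ ∃ C : ℝ, ∀ t : ℝ, 0 ≤ t → ‖u t‖ ≤ C := by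
  refine ⟨fun t => Real.exp (s * t) • v, fun t => ?_, ?_⟩
  · have h1 := (((hasDerivAt_id t).const_mul s).exp).smul_const v
    refine h1.congr_deriv ?_
    rw [map_smul, h, smul_smul]
    simp
  · rintro ⟨C, hC⟩
    have hv' : 0 < ‖v‖ := norm_pos_iff.2 hv
    have hC0 : 0 ≤ C := (norm_nonneg _).trans (hC 0 le_rfl)
    have h1 := hC (C / (s * ‖v‖)) (by positivity)
    rw [norm_smul, Real.norm_eq_abs, abs_of_pos (Real.exp_pos _)] at h1
    have h2 := Real.add_one_le_exp (s * (C / (s * ‖v‖)))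
    have h3 : s * (C / (s * ‖v‖)) * ‖v‖ = C := by field_simp
    nlinarith

lemma exists_unbounded_solution_of_jordan (L : Module.End ℝ V) {v w : V} (hv : v ≠ 0)
    (hLv : L v = 0) (hLw : L w = v) :
    ∃ u : ℝ → V, (∀ t : ℝ, HasDerivAt u (L (u t)) t) ∧
      ¬ ∃ C : ℝ, ∀ t : ℝ, 0 ≤ t → ‖u t‖ ≤ C := by
  refine ⟨fun t => w + t • v, fun t => ?_, ?_⟩
  · have h1 := ((hasDerivAt_id t).smul_const v).const_add w
    refine h1.congr_deriv ?_
    rw [map_add, map_smul, hLv, hLw]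
    simp
  · rintro ⟨C, hC⟩
    have hv' : 0 < ‖v‖ := norm_pos_iff.2 hv
    have hC0 : 0 ≤ C := (norm_nonneg _).trans (hC 0 le_rfl)
    set t := (C + ‖w‖ + 1) / ‖v‖ with ht
    have ht0 : 0 ≤ t := by positivity
    have h1 := hC t ht0
    have h2 : ‖t • v‖ ≤ ‖w + t • v‖ + ‖w‖ := by
      have := norm_sub_le (w + t • v) w
      rwa [add_sub_cancel_left] at this
    rw [norm_smul, Real.norm_eq_abs, abs_of_nonneg ht0, ht, div_mul_cancel₀ _ hv'.ne'] at h2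
    linarith

end Unbounded

/-- A growing eigenvector of the linearization in the slice makes the ring unstable. -/
lemma unstable_of_eigenvector (hN : 3 ≤ N) (hR : 0 < R) (Ω : ℝ) {v : Option (Fin N) → ℂ}
    (hv : v ∈ slice (ringStrength N l) (ringWithCentre N R)) (hv0 : v ≠ 0) {s : ℝ} (hs : 0 < s)
    (h : linearization N l R v = s • v) :
    LinearlyUnstable (ringStrength N l) Ω (ringAngularVelocity N l R Ω) (ringWithCentre N R) ∧
    SpectrallyUnstable (ringStrength N l) Ω (ringAngularVelocity N l R Ω)
      (ringWithCentre N R) := by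
  have hv0' : (⟨v, hv⟩ : slice (ringStrength N l) (ringWithCentre N R)) ≠ 0 := fun h' =>
    hv0 (congrArg Subtype.val h')
  have h' : sliceLinearization hN hR l ⟨v, hv⟩ = s • ⟨v, hv⟩ := Subtype.ext h
  exact ⟨⟨_, isSliceLinearization_sliceLinearization hN hR l Ω,
      exists_unbounded_solution_of_eigenvector _ hv0' hs h'⟩,
    ⟨_, isSliceLinearization_sliceLinearization hN hR l Ω, s,
      hasEigenvalue_baseChange _ hv0' h', by simpa using hs⟩⟩

/-- A nontrivial Jordan block for the eigenvalue `0` makes the ring linearly unstable. -/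
lemma linearlyUnstable_of_jordan (hN : 3 ≤ N) (hR : 0 < R) (Ω : ℝ) {w : Option (Fin N) → ℂ}
    (hw : w ∈ slice (ringStrength N l) (ringWithCentre N R)) (hv0 : linearization N l R w ≠ 0)
    (h : linearization N l R (linearization N l R w) = 0) :
    LinearlyUnstable (ringStrength N l) Ω (ringAngularVelocity N l R Ω)
      (ringWithCentre N R) := by
  have hv := linearization_mem_slice hN hR hw
  refine ⟨_, isSliceLinearization_sliceLinearization hN hR l Ω,
    exists_unbounded_solution_of_jordan _ (v := ⟨_, hv⟩) (w := ⟨w, hw⟩) ?_ ?_ ?_⟩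
  · exact fun h' => hv0 (congrArg Subtype.val h')
  · exact Subtype.ext h
  · rfl

/-! ### Instability of the modes of index near `N / 2` -/

/-- The displacement of the ring with equal Fourier coefficients of index `k` and `-k`. -/
noncomputable def pairMode (N k : ℕ) (a : ℂ) : Option (Fin N) → ℂ :=
  mode N (k + 1) a + mode N (1 - k) a

lemma smul_pairMode (k : ℕ) (r : ℝ) (a : ℂ) : r • pairMode N k a = pairMode N k (r * a) := by
  rw [pairMode, pairMode, smul_add, smul_mode, smul_mode]

lemma pairMode_zero (k : ℕ) : pairMode N k 0 = 0 := by
  have := smul_pairMode (N := N) k 0 0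
  simpa using this.symm

lemma pairMode_ne_zero (hN : 3 ≤ N) (k : ℕ) {a : ℂ} (ha : a ≠ 0) : pairMode N k a ≠ 0 := by
  intro h
  have h0 := congrFun h (some ⟨0, by omega⟩)
  have hv : vertex N ⟨0, by omega⟩ = 1 := by simp [vertex]
  simp only [pairMode, Pi.add_apply, mode, hv, one_zpow, mul_one, Pi.zero_apply] at h0
  exact ha (by linear_combination h0 / 2)

lemma not_dvd_of_lt {n : ℤ} (h0 : n ≠ 0) (h1 : -N < n) (h2 : n < N) : ¬ (N : ℤ) ∣ n := fun h =>
  h0 (Int.eq_zero_of_abs_lt_dvd h (by rw [abs_lt]; omega))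

lemma mode_mem_slice (hR : 0 < R) {n : ℤ} (hn : ¬ (N : ℤ) ∣ n - 1) (a : ℂ) :
    mode N n a ∈ slice (ringStrength N l) (ringWithCentre N R) := by
  rw [mem_slice_iff hR, coeff_mode, zero_add, if_neg hn, mul_zero]

lemma centre_mem_slice (hR : 0 < R) (c : ℂ) :
    centre N c ∈ slice (ringStrength N l) (ringWithCentre N R) := by
  rw [mem_slice_iff hR]
  simp [coeff, centre]

lemma pairMode_mem_slice (hR : 0 < R) {k : ℕ} (h1 : 0 < k) (h2 : k < N) (a : ℂ) :
    pairMode N k a ∈ slice (ringStrength N l) (ringWithCentre N R) :=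
  add_mem (mode_mem_slice hR (not_dvd_of_lt (by omega) (by omega) (by omega)) a)
    (mode_mem_slice hR (not_dvd_of_lt (by omega) (by omega) (by omega)) a)

lemma linearization_pairMode (hN : 3 ≤ N) (hR : 0 < R) {k : ℕ} (h1 : 2 ≤ k) (h2 : k + 2 ≤ N)
    (x y : ℝ) :
    linearization N l R (pairMode N k (x + y * Complex.I)) =
      frequency R • pairMode N k (((diagCoeff N l + pairCoeff N l k) * y : ℝ) +
        ((pairCoeff N l k - diagCoeff N l) * x : ℝ) * Complex.I) := by
  set a : ℂ := x + y * Complex.I with ha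
  have e : (frequency R : ℂ) * (((diagCoeff N l + pairCoeff N l k) * y : ℝ) +
      ((pairCoeff N l k - diagCoeff N l) * x : ℝ) * Complex.I) =
      -(Complex.I * frequency R * diagCoeff N l) * a +
        Complex.I * frequency R * pairCoeff N l k * (starRingEnd ℂ) a := by
    rw [ha, map_add, map_mul, Complex.conj_ofReal, Complex.conj_ofReal, Complex.conj_I]
    push_cast
    linear_combination (frequency R * y * (diagCoeff N l + pairCoeff N l k) : ℂ) * Complex.I_sq
  have hk := linearization_mode (l := l) hN hR (k := k) (by omega) a
  have hk' := linearization_mode (l := l) hN hR (k := N - k) (by omega) a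
  rw [if_neg (not_dvd_of_lt (by omega) (by omega) (by omega))] at hk hk'
  rw [pairCoeff_reflect (by omega), Nat.cast_sub (by omega)] at hk'
  have c1 : ∀ b : ℂ, mode N ((N : ℤ) - k + 1) b = mode N (1 - k) b :=
    fun b => mode_congr ⟨1, by ring⟩ b
  have c2 : ∀ b : ℂ, mode N (1 - ((N : ℤ) - k)) b = mode N (k + 1) b :=
    fun b => mode_congr ⟨-1, by ring⟩ b
  rw [c1, c1, c2] at hk'
  have c0 : centre N (0 : ℂ) = 0 := by funext o; rcases o with _ | j <;> rfl
  rw [mul_zero, c0, add_zero] at hk hk'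
  rw [smul_pairMode, e, pairMode, map_add, hk, hk', pairMode, mode_add, mode_add]
  abel

theorem linearlyUnstable_of_le_lowerThreshold (hN : 4 ≤ N) (hR : 0 < R) (Ω : ℝ)
    (hl : l ≤ lowerThreshold N) :
    LinearlyUnstable (ringStrength N l) Ω (ringAngularVelocity N l R Ω) (ringWithCentre N R) ∧
    (l < lowerThreshold N → SpectrallyUnstable (ringStrength N l) Ω
      (ringAngularVelocity N l R Ω) (ringWithCentre N R)) := by
  have hk1 : 2 ≤ N / 2 := by omega
  have hk2 : N / 2 + 2 ≤ N := by omega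
  set k := N / 2 with hk
  have hsum : 0 < diagCoeff N l + pairCoeff N l k := by
    rw [diagCoeff_add_pairCoeff]
    have h1 : (0 : ℝ) < k := by exact_mod_cast (by omega : 0 < k)
    have h2 : (k : ℝ) < N := by exact_mod_cast (by omega : k < N)
    exact mul_pos h1 (by linarith)
  have hdiff := diagCoeff_sub_pairCoeff_half (N := N) (l := l)
  rw [← hk] at hdiff
  have hκ := frequency_pos hR
  have hκ' : (frequency R : ℂ) ≠ 0 := by exact_mod_cast hκ.ne'
  have hmem := fun a => pairMode_mem_slice (l := l) hR (k := k) (N := N) (by omega) (by omega) a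
  rcases hl.lt_or_eq with hl | hl
  · -- the eigenvalue is `frequency R * s` with `s ^ 2 = pairCoeff ^ 2 - diagCoeff ^ 2`
    have hd : 0 < pairCoeff N l k - diagCoeff N l := by linarith
    set p := diagCoeff N l + pairCoeff N l k with hp
    set d := pairCoeff N l k - diagCoeff N l with hd'
    set s := Real.sqrt (p * d) with hs
    have hs0 : 0 < s := Real.sqrt_pos.2 (mul_pos hsum hd)
    have hss : s * s = p * d := Real.mul_self_sqrt (mul_pos hsum hd).le
    have h := linearization_pairMode (l := l) (by omega) hR hk1 hk2 p s
    rw [← hp, ← hd'] at h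
    have := unstable_of_eigenvector (by omega) hR Ω (hmem (p + s * Complex.I))
      (pairMode_ne_zero (by omega) k fun h0 => ?_) (mul_pos hκ hs0) ?_
    · exact ⟨this.1, fun _ => this.2⟩
    · have := congrArg Complex.re h0
      simp at this
      exact hsum.ne' this
    · rw [h, smul_pairMode, smul_pairMode]
      congr 1
      rw [show d * p = s * s by rw [hss, mul_comm]]
      push_cast
      ring
  · -- real displacements are in the kernel, and imaginary ones are mapped to real ones
    have hd : pairCoeff N l k - diagCoeff N l = 0 := by linarith
    refine ⟨?_, fun h => absurd hl h.ne⟩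
    have h := linearization_pairMode (l := l) (by omega) hR hk1 hk2 0 1
    rw [smul_pairMode, hd] at h
    refine linearlyUnstable_of_jordan (by omega) hR Ω (hmem _) (by
      rw [h]
      refine pairMode_ne_zero (by omega) k (mul_ne_zero hκ' ?_)
      have : (diagCoeff N l + pairCoeff N l k : ℂ) ≠ 0 := by exact_mod_cast hsum.ne'
      simpa using this) ?_
    have h' := linearization_pairMode (l := l) (by omega) hR hk1 hk2
      (frequency R * (diagCoeff N l + pairCoeff N l k)) 0
    rw [hd, smul_pairMode] at h'
    rw [h]
    convert h' using 2
    · congr 1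
      push_cast
      ring
    · simp [pairMode_zero]

/-! ### Instability of the modes that move the central vortex -/

/-- The displacement `a E_j ^ 2 + b` of the ring together with the displacement `c` of the central
vortex: the modes of index `1` and `-1`, which are the ones that move the central vortex. -/
noncomputable def centralMode (N : ℕ) (a b c : ℂ) : Option (Fin N) → ℂ :=
  mode N 2 a + mode N 0 b + centre N c

lemma smul_centralMode (r : ℝ) (a b c : ℂ) :
    r • centralMode N a b c = centralMode N (r * a) (r * b) (r * c) := by
  rw [centralMode, centralMode, smul_add, smul_add, smul_mode, smul_mode, smul_centre]

lemma centralMode_ne_zero {a b c : ℂ} (hc : c ≠ 0) : centralMode N a b c ≠ 0 := by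
  intro h
  have := congrFun h none
  simp [centralMode, mode, centre] at this
  exact hc this

lemma centralMode_mem_slice (hN : 3 ≤ N) (hR : 0 < R) (a b c : ℂ) :
    centralMode N a b c ∈ slice (ringStrength N l) (ringWithCentre N R) :=
  add_mem (add_mem (mode_mem_slice hR (not_dvd_of_lt (by omega) (by omega) (by omega)) a)
    (mode_mem_slice hR (not_dvd_of_lt (by omega) (by omega) (by omega)) b)) (centre_mem_slice hR c)

lemma linearization_mode_two (hN : 3 ≤ N) (hR : 0 < R) (a : ℂ) :
    linearization N l R (mode N 2 a) =
      centralMode N (-(Complex.I * frequency R * diagCoeff N l) * a)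
        (-(2 * Complex.I * frequency R * l) * (starRingEnd ℂ) a)
        (2 * Complex.I * frequency R * N * (starRingEnd ℂ) a) := by
  have h := linearization_mode (l := l) hN hR (k := 1) (by omega) a
  rw [if_pos (by simp), pairCoeff_one] at h
  norm_num at h
  rw [h, centralMode]
  ring_nf

lemma linearization_mode_zero (hN : 3 ≤ N) (hR : 0 < R) (b : ℂ) :
    linearization N l R (mode N 0 b) =
      mode N 0 (-(Complex.I * frequency R * diagCoeff N l) * b) +
        mode N 2 (-(2 * Complex.I * frequency R * l) * (starRingEnd ℂ) b) := by
  have h := linearization_mode (l := l) hN hR (k := N - 1) (by omega) b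
  rw [if_neg (not_dvd_of_lt (by omega) (by omega) (by omega)), pairCoeff_reflect (by omega),
    pairCoeff_one, Nat.cast_sub (by omega)] at h
  have c1 : ∀ b : ℂ, mode N ((N : ℤ) - ((1 : ℕ) : ℤ) + 1) b = mode N 0 b :=
    fun b => mode_congr ⟨1, by push_cast; ring⟩ b
  have c2 : ∀ b : ℂ, mode N (1 - ((N : ℤ) - ((1 : ℕ) : ℤ))) b = mode N 2 b :=
    fun b => mode_congr ⟨-1, by push_cast; ring⟩ b
  have c0 : centre N (0 : ℂ) = 0 := by funext o; rcases o with _ | j <;> rfl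
  rw [c1, c1, c2, mul_zero, c0, add_zero] at h
  rw [h]
  push_cast
  ring_nf

lemma linearization_centralMode (hN : 3 ≤ N) (hR : 0 < R) (a b c : ℂ) :
    linearization N l R (centralMode N a b c) =
      centralMode N
        (Complex.I * frequency R * (-diagCoeff N l * a - 2 * l * (starRingEnd ℂ) b +
          2 * l * (starRingEnd ℂ) c))
        (Complex.I * frequency R * (-diagCoeff N l * b - 2 * l * (starRingEnd ℂ) a))
        (Complex.I * frequency R * (-diagCoeff N l * c + 2 * N * (starRingEnd ℂ) a)) := by
  rw [centralMode, map_add, map_add, linearization_mode_two hN hR, linearization_mode_zero hN hR,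
    linearization_centre hN hR]
  funext o
  rcases o with _ | j <;> simp [centralMode, mode, centre] <;> ring

theorem linearlyUnstable_of_ge_upperThreshold (hN : 3 ≤ N) (hR : 0 < R) (Ω : ℝ)
    (hl : ((N : ℝ) - 1) ^ 2 / 4 ≤ l) :
    LinearlyUnstable (ringStrength N l) Ω (ringAngularVelocity N l R Ω) (ringWithCentre N R) ∧
    (((N : ℝ) - 1) ^ 2 / 4 < l → SpectrallyUnstable (ringStrength N l) Ω
      (ringAngularVelocity N l R Ω) (ringWithCentre N R)) := by
  have hN' : (3 : ℝ) ≤ N := by exact_mod_cast hN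
  have hN0 : (N : ℂ) ≠ 0 := by exact_mod_cast (by omega : N ≠ 0)
  have hκ := frequency_pos hR
  have hκ' : (frequency R : ℂ) ≠ 0 := by exact_mod_cast hκ.ne'
  have hA : 0 < diagCoeff N l := by unfold diagCoeff; nlinarith
  have hA' : (diagCoeff N l : ℂ) ≠ 0 := by exact_mod_cast hA.ne'
  have hsq := diagCoeff_sq_sub (N := N) (l := l)
  rcases hl.lt_or_eq with hl | hl
  · set s := Real.sqrt (4 * l - ((N : ℝ) - 1) ^ 2) with hs
    have hs0 : 0 < s := Real.sqrt_pos.2 (by linarith)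
    have hss : s ^ 2 = 4 * l - ((N : ℝ) - 1) ^ 2 := Real.sq_sqrt (by linarith)
    have hss' : (diagCoeff N l : ℂ) ^ 2 - 4 * l ^ 2 - 4 * l * N = -(s : ℂ) ^ 2 := by
      exact_mod_cast (by rw [hsq, hss]; ring :
        diagCoeff N l ^ 2 - 4 * l ^ 2 - 4 * l * N = -s ^ 2)
    -- the eigenvector solves the equations of the ring index `-1` and of the central vortex for
    -- the eigenvalue `frequency R * s`; the value of `s` comes from that of the index `1`
    have := unstable_of_eigenvector (l := l) hN hR Ω
      (centralMode_mem_slice hN hR (-(diagCoeff N l + s * Complex.I)) (2 * l) (-(2 * N)))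
      (centralMode_ne_zero (neg_ne_zero.2 (mul_ne_zero two_ne_zero hN0))) (mul_pos hκ hs0) ?_
    · exact ⟨this.1, fun _ => this.2⟩
    · rw [linearization_centralMode hN hR, smul_centralMode]
      simp only [map_neg, map_add, map_mul, Complex.conj_ofReal, Complex.conj_I, map_ofNat,
        map_natCast]
      congr 1
      · push_cast
        linear_combination Complex.I * frequency R * hss' +
          frequency R * diagCoeff N l * s * Complex.I_sq
      · push_cast
        linear_combination -(2 * l * s * frequency R : ℂ) * Complex.I_sq
      · push_cast
        linear_combination (2 * N * s * frequency R : ℂ) * Complex.I_sq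
  · refine ⟨?_, fun h => absurd hl h.ne⟩
    have hss' : (diagCoeff N l : ℂ) ^ 2 - 4 * l ^ 2 - 4 * l * N = 0 := by
      exact_mod_cast (by rw [hsq, ← hl]; ring :
        diagCoeff N l ^ 2 - 4 * l ^ 2 - 4 * l * N = 0)
    -- in the coordinates `conj a`, `b`, `c`, where the linearization is complex linear, the image
    -- of this vector is a multiple of the limit for `s → 0` of the eigenvector above
    have h := linearization_centralMode (l := l) hN hR 0 (-(2 * l)) (2 * N)
    simp only [map_zero, map_neg, map_mul, Complex.conj_ofReal, map_ofNat, map_natCast] at h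
    refine linearlyUnstable_of_jordan hN hR Ω
      (centralMode_mem_slice hN hR 0 (-(2 * l)) (2 * N)) (by
        rw [h]
        refine centralMode_ne_zero ?_
        simp [hκ', hA', hN0]) ?_
    rw [h, linearization_centralMode hN hR]
    simp only [map_neg, map_add, map_sub, map_mul, Complex.conj_ofReal, Complex.conj_I, map_ofNat,
      map_natCast, map_zero]
    have c0 : centralMode N 0 0 0 = 0 := by
      have := smul_centralMode (N := N) 0 0 0 0
      simpa using this.symm
    rw [← c0]
    congr 1
    · ring
    · linear_combination -(2 * l * Complex.I ^ 2 * frequency R ^ 2 : ℂ) * hss'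
    · linear_combination (2 * N * Complex.I ^ 2 * frequency R ^ 2 : ℂ) * hss'

/-! ### Ellipticity -/

lemma re_eq_zero_of_sq_eq_neg {m : ℂ} {r : ℝ} (hr : 0 ≤ r) (h : m ^ 2 = -(r : ℂ)) : m.re = 0 := by
  have h1 := congrArg Complex.re h
  have h2 := congrArg Complex.im h
  simp only [pow_two, Complex.mul_re, Complex.mul_im, Complex.neg_re, Complex.neg_im,
    Complex.ofReal_re, Complex.ofReal_im] at h1 h2
  by_contra hm
  have h3 : m.im = 0 := by
    have : m.re * m.im = 0 := by linarith
    exact (mul_eq_zero.1 this).resolve_left hm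
  rw [h3] at h1
  have := mul_self_pos.2 hm
  linarith

/-- The eigenvalue equations of a pair of modes have no solution with `m` off the imaginary axis if
the coupling `B` of the modes is at most `A`. -/
lemma pair_eq_zero {m φ ψ : ℂ} {κ A B : ℝ} (hm : m.re ≠ 0) (hAB : B ^ 2 ≤ A ^ 2)
    (h1 : m * φ = -(Complex.I * κ * A) * φ + Complex.I * κ * B * ψ)
    (h2 : m * ψ = Complex.I * κ * A * ψ - Complex.I * κ * B * φ) : φ = 0 ∧ ψ = 0 := by
  have hne : m ^ 2 + ((κ ^ 2 * (A ^ 2 - B ^ 2) : ℝ) : ℂ) ≠ 0 := fun h =>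
    hm (re_eq_zero_of_sq_eq_neg (mul_nonneg (sq_nonneg κ) (sub_nonneg.2 hAB))
      (eq_neg_of_add_eq_zero_left h))
  push_cast at hne
  constructor
  · refine (mul_eq_zero.1 ?_).resolve_left hne
    linear_combination (m - Complex.I * κ * A) * h1 + (Complex.I * κ * B) * h2 +
      κ ^ 2 * (A ^ 2 - B ^ 2) * φ * Complex.I_sq
  · refine (mul_eq_zero.1 ?_).resolve_left hne
    linear_combination (m + Complex.I * κ * A) * h2 - (Complex.I * κ * B) * h1 +
      κ ^ 2 * (A ^ 2 - B ^ 2) * ψ * Complex.I_sq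

/-- The eigenvalue equations of the modes that move the central vortex. -/
lemma central_eq_zero {m α β γ : ℂ} {κ A l n : ℝ} (hm : m.re ≠ 0)
    (hA : 0 ≤ A ^ 2 - 4 * l ^ 2 - 4 * l * n)
    (h1 : m * α = Complex.I * κ * (A * α + 2 * l * β - 2 * l * n * γ))
    (h2 : m * β = -(Complex.I * κ * (A * β + 2 * l * α)))
    (h3 : m * γ = -(Complex.I * κ * (A * γ - 2 * α))) : α = 0 ∧ β = 0 ∧ γ = 0 := by
  have hne : m ^ 2 + ((κ ^ 2 * (A ^ 2 - 4 * l ^ 2 - 4 * l * n) : ℝ) : ℂ) ≠ 0 := fun h =>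
    hm (re_eq_zero_of_sq_eq_neg (mul_nonneg (sq_nonneg κ) hA)
      (eq_neg_of_add_eq_zero_left h))
  push_cast at hne
  have hne' : m + Complex.I * κ * A ≠ 0 := by
    intro h
    apply hm
    have := congrArg Complex.re h
    simpa using this
  have hα : α = 0 := by
    refine (mul_eq_zero.1 ?_).resolve_left hne
    linear_combination (m + Complex.I * κ * A) * h1 + (2 * Complex.I * κ * l) * h2 -
      (2 * Complex.I * κ * l * n) * h3 +
      κ ^ 2 * (A ^ 2 - 4 * l ^ 2 - 4 * l * n) * α * Complex.I_sq
  refine ⟨hα, (mul_eq_zero.1 ?_).resolve_left hne', (mul_eq_zero.1 ?_).resolve_left hne'⟩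
  · linear_combination h2 - 2 * Complex.I * κ * l * hα
  · linear_combination h3 + 2 * Complex.I * κ * hα

lemma eq_zero_of_add_I_mul {x y : ℂ} (h1 : x + Complex.I * y = 0)
    (h2 : (starRingEnd ℂ) x + Complex.I * (starRingEnd ℂ) y = 0) : x = 0 ∧ y = 0 := by
  have h3 := congrArg (starRingEnd ℂ) h2
  simp only [map_add, map_mul, Complex.conj_conj, Complex.conj_I, map_zero] at h3
  have hx : x = 0 := by linear_combination (h1 + h3) / 2
  refine ⟨hx, ?_⟩
  rw [hx, zero_add] at h1
  exact (mul_eq_zero.1 h1).resolve_left Complex.I_ne_zero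

lemma eq_zero_of_coeff_slice {v : Option (Fin N) → ℂ} (hn : v none = 0)
    (h0 : coeff 0 (fun j => v (some j)) = 0) (h1 : coeff 1 (fun j => v (some j)) = 0)
    (h1' : coeff (-1) (fun j => v (some j)) = 0)
    (h : ∀ k : ℕ, 2 ≤ k → k + 2 ≤ N → coeff k (fun j => v (some j)) = 0) : v = 0 := by
  have hr : (fun j => v (some j)) = 0 := by
    refine eq_zero_of_coeff_eq_zero fun k hk => ?_
    have hk' := Finset.mem_range.1 hk
    rcases Nat.lt_or_ge k 2 with h2 | h2
    · interval_cases k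
      · exact h0
      · exact h1
    · rcases Nat.lt_or_ge N (k + 2) with h3 | h3
      · rw [coeff_congr (n := -1) ⟨1, by omega⟩]
        exact h1'
      · exact h k h2 h3
  funext o
  rcases o with _ | j
  · exact hn
  · exact congrFun hr j

/-- If every coupling of a pair of modes is at most `diagCoeff N l`, then all eigenvalues are
imaginary. -/
theorem spectrallyStable_ring (hN : 3 ≤ N) (hR : 0 < R) (Ω : ℝ)
    (hl : 4 * l ≤ ((N : ℝ) - 1) ^ 2)
    (hB : ∀ k : ℕ, 2 ≤ k → k + 2 ≤ N → pairCoeff N l k ^ 2 ≤ diagCoeff N l ^ 2) :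
    SpectrallyStable (ringStrength N l) Ω (ringAngularVelocity N l R Ω)
      (ringWithCentre N R) := by
  refine ⟨_, isSliceLinearization_sliceLinearization hN hR l Ω, fun m hev => ?_⟩
  by_contra hm
  obtain ⟨⟨a, ha⟩, ⟨b, hb⟩, hne, hLa, hLb⟩ := exists_real_pair_of_hasEigenvalue _ hev
  replace hLa : linearization N l R a = m.re • a - m.im • b := congrArg Subtype.val hLa
  replace hLb : linearization N l R b = m.im • a + m.re • b := congrArg Subtype.val hLb
  have ha0 := (mem_slice_iff hR a).1 ha
  have hb0 := (mem_slice_iff hR b).1 hb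
  apply hne
  -- the eigenvalue equation in terms of a Fourier coefficient and its conjugate
  have hsm : ∀ (k : ℤ) (r s : ℝ) (u v : Option (Fin N) → ℂ),
      coeff k (fun j => (r • u + s • v) (some j)) =
        r * coeff k (fun j => u (some j)) + s * coeff k (fun j => v (some j)) := by
    intro k r s u v
    simp only [coeff, Finset.mul_sum, ← Finset.sum_add_distrib]
    refine Finset.sum_congr rfl fun j _ => ?_
    simp
    ring
  have hLa' : linearization N l R a = m.re • a + (-m.im) • b := by
    rw [hLa, neg_smul, sub_eq_add_neg]
  have e1 : ∀ x y : ℂ, ((m.re : ℂ) * x + ((-m.im : ℝ) : ℂ) * y) +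
      Complex.I * ((m.im : ℂ) * x + (m.re : ℂ) * y) = m * (x + Complex.I * y) := by
    intro x y
    nth_rewrite 5 [← Complex.re_add_im m]
    push_cast
    linear_combination -(m.im * y : ℂ) * Complex.I_sq
  have hc : ∀ k : ℤ, m * (coeff k (fun j => a (some j)) +
      Complex.I * coeff k (fun j => b (some j))) =
      coeff k (fun j => linearization N l R a (some j)) +
        Complex.I * coeff k (fun j => linearization N l R b (some j)) := by
    intro k
    rw [hLa', hLb, hsm, hsm, e1]
  have hcc : ∀ k : ℤ, m * ((starRingEnd ℂ) (coeff k (fun j => a (some j))) +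
      Complex.I * (starRingEnd ℂ) (coeff k (fun j => b (some j)))) =
      (starRingEnd ℂ) (coeff k (fun j => linearization N l R a (some j))) +
        Complex.I * (starRingEnd ℂ) (coeff k (fun j => linearization N l R b (some j))) := by
    intro k
    rw [hLa', hLb, hsm, hsm, ← e1]
    simp only [map_add, map_mul, Complex.conj_ofReal]
  have hn : m * (a none + Complex.I * b none) =
      linearization N l R a none + Complex.I * linearization N l R b none := by
    rw [hLa', hLb, ← e1]
    simp
  have hnc : m * ((starRingEnd ℂ) (a none) + Complex.I * (starRingEnd ℂ) (b none)) =
      (starRingEnd ℂ) (linearization N l R a none) +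
        Complex.I * (starRingEnd ℂ) (linearization N l R b none) := by
    rw [hLa', hLb, ← e1]
    simp
  have hreflect : ∀ (k : ℕ) (u : Option (Fin N) → ℂ), k ≤ N →
      coeff ((N - k : ℕ) : ℤ) (fun j => u (some j)) = coeff (-k) (fun j => u (some j)) ∧
      coeff (-((N - k : ℕ) : ℤ)) (fun j => u (some j)) = coeff k (fun j => u (some j)) := by
    intro k u hk
    constructor
    · exact coeff_congr ⟨1, by omega⟩ _
    · exact coeff_congr ⟨-1, by omega⟩ _
  have hpair : ∀ k : ℕ, 2 ≤ k → k + 2 ≤ N →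
      coeff k (fun j => a (some j)) = 0 ∧ coeff k (fun j => b (some j)) = 0 := by
    have key : ∀ k : ℕ, 2 ≤ k → k + 2 ≤ N →
        coeff k (fun j => a (some j)) + Complex.I * coeff k (fun j => b (some j)) = 0 ∧
        (starRingEnd ℂ) (coeff (-k) (fun j => a (some j))) +
          Complex.I * (starRingEnd ℂ) (coeff (-k) (fun j => b (some j))) = 0 := by
      intro k h1 h2
      have hk := fun u => coeff_linearization (l := l) hR u (k := k) (N := N) (by omega)
      have hk' := fun u => coeff_linearization (l := l) hR u (k := N - k) (N := N) (by omega)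
      simp only [(hreflect k _ (by omega)).1, (hreflect k _ (by omega)).2] at hk'
      rw [if_neg (not_dvd_of_lt (by omega) (by omega) (by omega))] at hk hk'
      rw [pairCoeff_reflect (by omega)] at hk'
      refine pair_eq_zero (κ := frequency R) hm (hB k h1 h2) ?_ ?_
      · rw [hc, hk, hk]
        ring
      · rw [hcc, hk', hk']
        simp only [map_add, map_mul, map_neg, Complex.conj_ofReal, Complex.conj_I,
          Complex.conj_conj, mul_zero, zero_mul, map_zero]
        ring
    intro k h1 h2
    have h3 := (key (N - k) (by omega) (by omega)).2
    rw [(hreflect k _ (by omega)).2, (hreflect k _ (by omega)).2] at h3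
    exact eq_zero_of_add_I_mul (key k h1 h2).1 h3
  have hcentral : ∀ u : Option (Fin N) → ℂ,
      (coeff 1 (fun j => linearization N l R u (some j)) =
        -(Complex.I * frequency R * diagCoeff N l) * coeff 1 (fun j => u (some j)) -
        2 * Complex.I * frequency R * l * (starRingEnd ℂ) (coeff (-1) fun j => u (some j)) +
        2 * Complex.I * frequency R * l * N * (starRingEnd ℂ) (u none)) ∧
      (coeff (-1) (fun j => linearization N l R u (some j)) =
        -(Complex.I * frequency R * diagCoeff N l) * coeff (-1) (fun j => u (some j)) -
        2 * Complex.I * frequency R * l * (starRingEnd ℂ) (coeff 1 fun j => u (some j))) := by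
    intro u
    constructor
    · have h := coeff_linearization (l := l) hR u (k := 1) (N := N) (by omega)
      rw [if_pos (by simp), pairCoeff_one] at h
      push_cast at h
      rw [h]
      ring
    · have h := coeff_linearization (l := l) hR u (k := N - 1) (N := N) (by omega)
      rw [if_neg (not_dvd_of_lt (by omega) (by omega) (by omega)), pairCoeff_reflect (by omega),
        pairCoeff_one, (hreflect 1 _ (by omega)).1, (hreflect 1 _ (by omega)).1,
        (hreflect 1 _ (by omega)).2] at h
      push_cast at h
      rw [h]
      ring
  have hA : 0 ≤ diagCoeff N l ^ 2 - 4 * l ^ 2 - 4 * l * N := by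
    rw [diagCoeff_sq_sub]; linarith
  have k1 := central_eq_zero (κ := frequency R) (A := diagCoeff N l) (l := l) (n := N) hm hA
    (α := (starRingEnd ℂ) (coeff 1 (fun j => a (some j))) +
      Complex.I * (starRingEnd ℂ) (coeff 1 (fun j => b (some j))))
    (β := coeff (-1) (fun j => a (some j)) + Complex.I * coeff (-1) (fun j => b (some j)))
    (γ := a none + Complex.I * b none)
    (by
      rw [hcc, (hcentral a).1, (hcentral b).1]
      simp only [map_add, map_sub, map_mul, map_neg, Complex.conj_ofReal, Complex.conj_I,
        Complex.conj_conj, map_ofNat, map_natCast]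
      push_cast
      ring)
    (by rw [hc, (hcentral a).2, (hcentral b).2]; ring)
    (by rw [hn, linearization_none hN hR, linearization_none hN hR]; ring)
  have k2 := central_eq_zero (κ := -frequency R) (A := diagCoeff N l) (l := l) (n := N) hm hA
    (α := coeff 1 (fun j => a (some j)) + Complex.I * coeff 1 (fun j => b (some j)))
    (β := (starRingEnd ℂ) (coeff (-1) (fun j => a (some j))) +
      Complex.I * (starRingEnd ℂ) (coeff (-1) (fun j => b (some j))))
    (γ := (starRingEnd ℂ) (a none) + Complex.I * (starRingEnd ℂ) (b none))
    (by
      rw [hc, (hcentral a).1, (hcentral b).1]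
      push_cast
      ring)
    (by
      rw [hcc, (hcentral a).2, (hcentral b).2]
      simp only [map_sub, map_mul, map_neg, Complex.conj_ofReal, Complex.conj_I,
        Complex.conj_conj, map_ofNat]
      push_cast
      ring)
    (by
      rw [hnc, linearization_none hN hR, linearization_none hN hR]
      simp only [map_add, map_mul, map_neg, Complex.conj_ofReal, Complex.conj_I,
        Complex.conj_conj, map_ofNat]
      push_cast
      ring)
  have hα := eq_zero_of_add_I_mul k2.1 k1.1
  have hβ := eq_zero_of_add_I_mul k1.2.1 k2.2.1
  have hγ := eq_zero_of_add_I_mul k1.2.2 k2.2.2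
  exact ⟨Subtype.ext (eq_zero_of_coeff_slice hγ.1 ha0 hα.1 hβ.1 fun k h1 h2 => (hpair k h1 h2).1),
    Subtype.ext (eq_zero_of_coeff_slice hγ.2 hb0 hα.2 hβ.2 fun k h1 h2 => (hpair k h1 h2).2)⟩

/-- With a central vortex of negative strength, the second derivative does not have the same strict
sign on displacements of the centre and on translations of the ring. -/
theorem not_definiteOnSlice_ring (hN : 3 ≤ N) (hR : 0 < R) (Ω : ℝ) (hl : l < 0) :
    ¬ DefiniteOnSlice (ringStrength N l) Ω (ringAngularVelocity N l R Ω)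
      (ringWithCentre N R) := by
  have hκ := frequency_pos hR
  have hN' : (0 : ℝ) < N := by exact_mod_cast (by omega : 0 < N)
  have h1 : hessian (ringStrength N l) Ω (ringAngularVelocity N l R Ω) (ringWithCentre N R)
      (mode N 0 1) (mode N 0 1) = -(frequency R * diagCoeff N l * N) := by
    have hre : ∑ j : Fin N, (vertex N j ^ (2 : ℤ)).re = 0 := by
      rw [← Complex.re_sum, sum_vertex_zpow_eq_zero hN (by norm_num) (by norm_num) (by norm_num),
        Complex.zero_re]
    have e : symplecticForm (ringStrength N l) (linearization N l R (mode N 0 1)) (mode N 0 1) =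
        ∑ j : Fin N, (-(frequency R * diagCoeff N l) -
          2 * frequency R * l * (vertex N j ^ (2 : ℤ)).re) := by
      rw [linearization_mode_zero hN hR, symplecticForm, Fintype.sum_option]
      simp [mode, ringStrength, Finset.sum_add_distrib, sub_eq_add_neg]
    rw [hessian_ring hR, e, Finset.sum_sub_distrib, ← Finset.mul_sum, hre]
    simp
    ring
  have h2 : hessian (ringStrength N l) Ω (ringAngularVelocity N l R Ω) (ringWithCentre N R)
      (centre N 1) (centre N 1) = -(frequency R * diagCoeff N l * l) := by
    rw [hessian_ring hR, linearization_centre hN hR, symplecticForm, Fintype.sum_option]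
    simp [mode, centre, ringStrength]
    ring
  have m1 : mode N 0 1 ∈ slice (ringStrength N l) (ringWithCentre N R) :=
    mode_mem_slice hR (not_dvd_of_lt (by omega) (by omega) (by omega)) 1
  have m2 : centre N 1 ∈ slice (ringStrength N l) (ringWithCentre N R) := centre_mem_slice hR 1
  have n1 : mode N 0 1 ≠ 0 := fun h => by
    have := congrFun h (some ⟨0, by omega⟩)
    simp [mode] at this
  have n2 : centre N 1 ≠ 0 := fun h => by
    have := congrFun h none
    simp [centre] at this
  have hneg : (frequency R * diagCoeff N l * N) * (frequency R * diagCoeff N l * l) ≤ 0 := by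
    have : (frequency R * diagCoeff N l * N) * (frequency R * diagCoeff N l * l) =
      (frequency R * diagCoeff N l) ^ 2 * N * l := by ring
    rw [this]
    exact mul_nonpos_of_nonneg_of_nonpos (by positivity) hl.le
  rintro (h | h)
  · have a1 := h _ m1 n1
    have a2 := h _ m2 n2
    rw [h1] at a1
    rw [h2] at a2
    nlinarith
  · have a1 := h _ m1 n1
    have a2 := h _ m2 n2
    rw [h1] at a1
    rw [h2] at a2
    nlinarith

/-! ### Nondegenerate minima and global flows -/

section General

variable {E : Type*} [NormedAddCommGroup E] [NormedSpace ℝ E]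

lemma exists_pos_le_of_posDef [FiniteDimensional ℝ E] (q : E →L[ℝ] E →L[ℝ] ℝ) (W : Submodule ℝ E)
    (hpos : ∀ v ∈ W, v ≠ 0 → 0 < q v v) : ∃ c > 0, ∀ v ∈ W, c * ‖v‖ ^ 2 ≤ q v v := by
  have hcpt : IsCompact {v : E | v ∈ W ∧ ‖v‖ = 1} := by
    have h1 : {v : E | v ∈ W ∧ ‖v‖ = 1} = (W : Set E) ∩ Metric.sphere 0 1 := by
      ext v; simp
    rw [h1]
    exact (isCompact_sphere 0 1).inter_left W.closed_of_finiteDimensional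
  have hcont : Continuous fun v => q v v := by fun_prop
  have hscale : ∀ c : ℝ, (∀ v ∈ W, ‖v‖ = 1 → c ≤ q v v) → ∀ v ∈ W, c * ‖v‖ ^ 2 ≤ q v v := by
    intro c hc v hv
    rcases eq_or_ne v 0 with h0 | h0
    · simp [h0]
    have hn : ‖v‖ ≠ 0 := norm_ne_zero_iff.2 h0
    have h := hc (‖v‖⁻¹ • v) (W.smul_mem _ hv) (by
      rw [norm_smul, norm_inv, norm_norm, inv_mul_cancel₀ hn])
    have e : q v v = ‖v‖ ^ 2 * q (‖v‖⁻¹ • v) (‖v‖⁻¹ • v) := by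
      simp only [map_smul, smul_apply, smul_eq_mul]
      field_simp
    rw [e, mul_comm]
    exact mul_le_mul_of_nonneg_left h (by positivity)
  rcases Set.eq_empty_or_nonempty {v : E | v ∈ W ∧ ‖v‖ = 1} with he | hne
  · refine ⟨1, one_pos, hscale 1 fun v hv h1 => ?_⟩
    exact absurd (show v ∈ {v : E | v ∈ W ∧ ‖v‖ = 1} from ⟨hv, h1⟩) (by rw [he]; simp)
  · obtain ⟨v0, hv0, hmin⟩ := hcpt.exists_isMinOn hne hcont.continuousOn
    have hv00 : v0 ≠ 0 := fun h => by simpa [h] using hv0.2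
    exact ⟨q v0 v0, hpos v0 hv0.1 hv00, hscale _ fun v hv h1 => hmin ⟨hv, h1⟩⟩

/-- A critical point with a second derivative that is positive definite on a subspace is a strict
local minimum along that subspace, with at least quadratic growth. -/
lemma exists_quadratic_growth [FiniteDimensional ℝ E] {f : E → ℝ} {x : E}
    {q : E →L[ℝ] E →L[ℝ] ℝ} (hf : ∀ᶠ z in 𝓝 x, DifferentiableAt ℝ f z) (hx : fderiv ℝ f x = 0)
    (hq : HasFDerivAt (fderiv ℝ f) q x) (W : Submodule ℝ E)
    (hpos : ∀ v ∈ W, v ≠ 0 → 0 < q v v) :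
    ∃ c > 0, ∃ δ > 0, ∀ v ∈ W, ‖v‖ ≤ δ → f x + c * ‖v‖ ^ 2 ≤ f (x + v) := by
  obtain ⟨c₀, hc₀, hcq⟩ := exists_pos_le_of_posDef q W hpos
  set c := c₀ / 4 with hc
  have hcpos : 0 < c := by positivity
  have hlo := (hasFDerivAt_iff_isLittleO.1 hq).def hcpos
  obtain ⟨ε, hε, hball⟩ := Metric.eventually_nhds_iff.1 (hf.and hlo)
  refine ⟨c, hcpos, ε / 2, by positivity, fun v hv hvε => ?_⟩
  have hmem : ∀ s ∈ Set.Icc (0 : ℝ) 1, dist (x + s • v) x < ε := by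
    intro s hs
    rw [dist_eq_norm, add_sub_cancel_left, norm_smul, Real.norm_eq_abs, abs_of_nonneg hs.1]
    nlinarith [hs.2, norm_nonneg v]
  have hline : ∀ s : ℝ, HasDerivAt (fun s : ℝ => x + s • v) v s := fun s => by
    simpa using ((hasDerivAt_id s).smul_const v).const_add x
  have hder : ∀ s ∈ Set.Icc (0 : ℝ) 1, HasDerivAt (fun s : ℝ => f (x + s • v) - c * ‖v‖ ^ 2 * s ^ 2)
      (fderiv ℝ f (x + s • v) v - c * ‖v‖ ^ 2 * (2 * s)) s := by
    intro s hs
    have h1 := (hball (hmem s hs)).1.hasFDerivAt.comp_hasDerivAt s (hline s)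
    have h2 := (hasDerivAt_pow 2 s).const_mul (c * ‖v‖ ^ 2)
    exact (h1.sub h2).congr_deriv (by simp)
  have hnonneg : ∀ s ∈ Set.Icc (0 : ℝ) 1,
      0 ≤ fderiv ℝ f (x + s • v) v - c * ‖v‖ ^ 2 * (2 * s) := by
    intro s hs
    have h1 := (hball (hmem s hs)).2
    rw [hx, sub_zero, add_sub_cancel_left] at h1
    have h2 := (fderiv ℝ f (x + s • v) - q (s • v)).le_of_opNorm_le h1 v
    rw [sub_apply, map_smul, smul_apply, smul_eq_mul,
      norm_smul, Real.norm_eq_abs, Real.norm_eq_abs, abs_of_nonneg hs.1] at h2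
    have h3 := (abs_le.1 h2).1
    have h4 := mul_le_mul_of_nonneg_left (hcq v hv) hs.1
    have h5 : s * (c₀ * ‖v‖ ^ 2) = 4 * (c * ‖v‖ ^ 2 * s) := by rw [hc]; ring
    have h6 : 0 ≤ c * ‖v‖ ^ 2 * s := mul_nonneg (by positivity) hs.1
    nlinarith
  have hmono : MonotoneOn (fun s : ℝ => f (x + s • v) - c * ‖v‖ ^ 2 * s ^ 2) (Set.Icc 0 1) := by
    refine monotoneOn_of_deriv_nonneg (convex_Icc 0 1)
      (fun s hs => (hder s hs).continuousAt.continuousWithinAt)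
      (fun s hs => (hder s (interior_subset hs)).differentiableAt.differentiableWithinAt)
      fun s hs => ?_
    rw [(hder s (interior_subset hs)).deriv]
    exact hnonneg s (interior_subset hs)
  have := hmono (Set.left_mem_Icc.2 zero_le_one) (Set.right_mem_Icc.2 zero_le_one) zero_le_one
  simp only [zero_smul, add_zero, one_smul] at this
  linarith

/-- A bounded Lipschitz vector field has global integral curves. -/
lemma exists_global_solution [CompleteSpace E] {v : E → E} {K : NNReal} (hv : LipschitzWith K v)
    {C : ℝ} (hC : ∀ x, ‖v x‖ ≤ C) (y : E) :
    ∃ γ : ℝ → E, γ 0 = y ∧ ∀ t, HasDerivAt γ (v (γ t)) t := by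
  have hC0 : 0 ≤ C := (norm_nonneg _).trans (hC 0)
  have hloc : ∀ n : ℕ, ∃ α : ℝ → E, α 0 = y ∧
      ∀ t ∈ Set.Ioo (-((n : ℝ) + 1)) (n + 1), HasDerivAt α (v (α t)) t := by
    intro n
    have hn : (0 : ℝ) < n + 1 := by positivity
    have hpl : IsPicardLindelof (fun _ : ℝ => v) (tmin := -((n : ℝ) + 1)) (tmax := n + 1)
        ⟨0, by constructor <;> linarith⟩ y (C.toNNReal * (n + 1)) 0 C.toNNReal K := by
      refine ⟨fun _ _ => hv.lipschitzOnWith, fun _ _ => continuousOn_const, fun _ _ x _ => ?_, ?_⟩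
      · rw [Real.coe_toNNReal C hC0]; exact hC x
      · simp [Real.coe_toNNReal C hC0]
    obtain ⟨α, h0, hα⟩ := hpl.exists_eq_forall_mem_Icc_hasDerivWithinAt₀
    exact ⟨α, h0, fun t ht =>
      (hα t (Set.Ioo_subset_Icc_self ht)).hasDerivAt (Icc_mem_nhds ht.1 ht.2)⟩
  choose α h0 hα using hloc
  have huniq : ∀ m n : ℕ, m ≤ n → ∀ t ∈ Set.Ioo (-((m : ℝ) + 1)) (m + 1), α m t = α n t := by
    intro m n hmn t ht
    have hmn' : (m : ℝ) ≤ n := by exact_mod_cast hmn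
    have hm : (0 : ℝ) < m + 1 := by positivity
    refine ODE_solution_unique_of_mem_Ioo (v := fun _ => v) (s := fun _ => Set.univ) (K := K)
      (t₀ := 0) (fun _ _ => hv.lipschitzOnWith) ⟨by linarith, hm⟩
      (fun s hs => ⟨hα m s hs, trivial⟩) (fun s hs => ⟨hα n s ⟨?_, ?_⟩, trivial⟩)
      ((h0 m).trans (h0 n).symm) ht
    · linarith [hs.1]
    · linarith [hs.2]
  refine ⟨fun t => α ⌈|t|⌉₊ t, h0 _, fun t => ?_⟩
  have hmem : ∀ s : ℝ, ∀ n : ℕ, ⌈|s|⌉₊ ≤ n → s ∈ Set.Ioo (-((n : ℝ) + 1)) (n + 1) := by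
    intro s n h
    have h1 : |s| ≤ n := Nat.ceil_le.1 h
    have h2 := abs_le.1 h1
    exact ⟨by linarith [h2.1], by linarith [h2.2]⟩
  have heq : ∀ s : ℝ, ∀ n : ℕ, ⌈|s|⌉₊ ≤ n → α ⌈|s|⌉₊ s = α n s := fun s n h =>
    huniq _ n h s (hmem s _ le_rfl)
  have hev : (fun s => α ⌈|s|⌉₊ s) =ᶠ[𝓝 t] α (⌈|t|⌉₊ + 1) := by
    have hlt : |t| < ((⌈|t|⌉₊ + 1 : ℕ) : ℝ) := by
      have := Nat.le_ceil |t|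
      push_cast
      linarith
    filter_upwards [(isOpen_lt continuous_abs continuous_const).mem_nhds hlt] with s hs
    exact heq s _ (Nat.ceil_le.2 (le_of_lt hs))
  have hd := hα (⌈|t|⌉₊ + 1) t (hmem t _ (by omega))
  rw [← heq t _ (by omega)] at hd
  exact hd.congr_of_eventuallyEq hev

open scoped Manifold in
/-- A vector field that is `C¹` on an open set agrees on a given compact subset with a bounded
Lipschitz multiple of itself. -/
lemma exists_cutoff [FiniteDimensional ℝ E] {X : E → E} {S K : Set E} (hS : IsOpen S)
    (hX : ∀ z ∈ S, ContDiffAt ℝ 1 X z) (hK : IsCompact K) (hKS : K ⊆ S) :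
    ∃ χ : E → ℝ, (∀ z ∈ K, χ z = 1) ∧ (∃ L, LipschitzWith L fun z => χ z • X z) ∧
      ∃ C, ∀ z, ‖χ z • X z‖ ≤ C := by
  obtain ⟨K', hK', hKK', hK'S⟩ := exists_compact_between hK hS hKS
  obtain ⟨χ, h0, h1, -⟩ := exists_contMDiffMap_zero_one_of_isClosed (n := 1) 𝓘(ℝ, E)
    (isOpen_interior (s := K')).isClosed_compl hK.isClosed
    (Set.disjoint_left.2 fun z hz hz' => hz (hKK' hz'))
  have hχ : ContDiff ℝ 1 χ := (χ.contMDiff.contDiff).of_le (by simp)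
  have hsupp : ∀ z, z ∉ K' → χ z • X z = 0 := fun z hz => by
    rw [h0 fun h => hz (interior_subset h)]; simp
  have hC1 : ContDiff ℝ 1 fun z => χ z • X z := by
    refine contDiff_iff_contDiffAt.2 fun z => ?_
    by_cases hz : z ∈ S
    · exact hχ.contDiffAt.smul (hX z hz)
    · have hz' : z ∈ K'ᶜ := fun h => hz (hK'S h)
      refine (contDiffAt_const (c := (0 : E))).congr_of_eventuallyEq ?_
      filter_upwards [hK'.isClosed.isOpen_compl.mem_nhds hz'] with w hw
      exact hsupp w hw
  have hcs : HasCompactSupport fun z => χ z • X z := HasCompactSupport.intro hK' hsupp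
  exact ⟨χ, fun z hz => h1 hz, ContDiff.lipschitzWith_of_hasCompactSupport hcs hC1 (by simp),
    hC1.continuous.bounded_above_of_compact_support hcs⟩

end General

/-! ### Nonlinear stability -/

section Stability

variable {ι : Type} [Fintype ι] [DecidableEq ι]

/-- The Hermitian product `∑_j conj (x_j) z_j`. -/
noncomputable def overlap (x z : ι → ℂ) : ℂ := ∑ j, (starRingEnd ℂ) (x j) * z j

/-- The squared Euclidean distance of `z` from the `SO(2)`-orbit of `x`. -/
noncomputable def orbitDistSq (x z : ι → ℂ) : ℝ :=
  ∑ j, ‖z j‖ ^ 2 + ∑ j, ‖x j‖ ^ 2 - 2 * ‖overlap x z‖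

/-- The orthogonal complement of the tangent space of the `SO(2)`-orbit of `x`. -/
noncomputable def orbitNormal (x : ι → ℂ) : Submodule ℝ (ι → ℂ) where
  carrier := {v | (overlap x v).im = 0}
  zero_mem' := by simp [overlap]
  add_mem' := by
    intro u v hu hv
    simp only [Set.mem_ofPred_eq, overlap, Pi.add_apply, mul_add, Finset.sum_add_distrib,
      Complex.add_im] at hu hv ⊢
    rw [hu, hv, add_zero]
  smul_mem' := by
    intro c v hv
    simp only [Set.mem_ofPred_eq, overlap, Pi.smul_apply, mul_smul_comm, ← Finset.smul_sum,
      Complex.smul_im] at hv ⊢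
    rw [hv, smul_zero]

omit [DecidableEq ι] in
lemma mem_orbitNormal {x v : ι → ℂ} : v ∈ orbitNormal x ↔ (overlap x v).im = 0 := Iff.rfl

omit [DecidableEq ι] in
lemma overlap_self (x : ι → ℂ) : overlap x x = ((∑ j, ‖x j‖ ^ 2 : ℝ) : ℂ) := by
  rw [overlap, Complex.ofReal_sum]
  exact Finset.sum_congr rfl fun j _ => by rw [Complex.conj_mul']; push_cast; rfl

omit [DecidableEq ι] in
lemma continuous_orbitDistSq (x : ι → ℂ) : Continuous (orbitDistSq x) := by
  unfold orbitDistSq overlap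
  fun_prop

omit [DecidableEq ι] in
lemma orbitDistSq_self (x : ι → ℂ) : orbitDistSq x x = 0 := by
  have h : 0 ≤ ∑ j, ‖x j‖ ^ 2 := Finset.sum_nonneg fun j _ => sq_nonneg _
  rw [orbitDistSq, overlap_self, Complex.norm_real, Real.norm_eq_abs, abs_of_nonneg h]
  ring

omit [DecidableEq ι] in
/-- Every configuration can be turned so that its displacement from `x` is orthogonal to the orbit
of `x` and realizes the distance from the orbit. -/
lemma exists_rotate_sub_mem_orbitNormal (x z : ι → ℂ) : ∃ θ : ℝ,
    rotate θ z - x ∈ orbitNormal x ∧ ∑ j, ‖(rotate θ z - x) j‖ ^ 2 = orbitDistSq x z := by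
  set θ := -(overlap x z).arg with hθ
  have h1 : overlap x (rotate θ z) = ‖overlap x z‖ := by
    have h2 : overlap x (rotate θ z) = Complex.exp ((θ : ℂ) * Complex.I) * overlap x z := by
      rw [overlap, overlap, Finset.mul_sum]
      exact Finset.sum_congr rfl fun j _ => by rw [rotate]; ring
    rw [h2]
    nth_rewrite 1 [← Complex.norm_mul_exp_arg_mul_I (overlap x z)]
    rw [mul_left_comm, ← Complex.exp_add, hθ]
    push_cast
    rw [neg_mul, neg_add_cancel, Complex.exp_zero, mul_one]
  refine ⟨θ, ?_, ?_⟩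
  · rw [mem_orbitNormal]
    have : overlap x (rotate θ z - x) = overlap x (rotate θ z) - overlap x x := by
      rw [overlap, overlap, overlap, ← Finset.sum_sub_distrib]
      exact Finset.sum_congr rfl fun j _ => by rw [Pi.sub_apply]; ring
    rw [this, h1, overlap_self, Complex.sub_im, Complex.ofReal_im, Complex.ofReal_im, sub_zero]
  · have h3 : ∀ j, ‖(rotate θ z - x) j‖ ^ 2 =
        ‖z j‖ ^ 2 + ‖x j‖ ^ 2 - 2 * ((starRingEnd ℂ) (x j) * rotate θ z j).re := by
      intro j
      rw [← norm_rotate_apply θ z j, Pi.sub_apply]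
      simp only [Complex.sq_norm, Complex.normSq_apply, Complex.sub_re, Complex.sub_im,
        Complex.mul_re, Complex.conj_re, Complex.conj_im]
      ring
    rw [Finset.sum_congr rfl fun j _ => h3 j, Finset.sum_sub_distrib, Finset.sum_add_distrib,
      ← Finset.mul_sum, ← Complex.re_sum, ← overlap, h1, Complex.ofReal_re, orbitDistSq]

/-- Along a curve that starts near the orbit of `x` and follows the motion, up to a
reparametrization `r` of time, as long as it stays near the orbit, a function `F` that is conserved
by the motion confines the curve if `F` is small at the start and large at a fixed distance. -/
lemma orbitDistSq_lt_of_conserved (Γ : ι → ℝ) (Ω Ω' : ℝ) {x : ι → ℂ} {ρ h : ℝ}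
    (hphase : ∀ z, orbitDistSq x z ≤ ρ → z ∈ phaseSpace ι)
    (hbar : ∀ z, orbitDistSq x z = ρ → hamiltonian Γ Ω' z ≤ h)
    {γ : ℝ → ι → ℂ} (hγ : ContinuousOn γ (Set.Ici 0)) (h0 : orbitDistSq x (γ 0) < ρ)
    (hH : h < hamiltonian Γ Ω' (γ 0)) (r : ℝ → ℝ)
    (hder : ∀ t, 0 ≤ t → orbitDistSq x (γ t) ≤ ρ →
      HasDerivWithinAt γ (r t • velocity Γ Ω (γ t)) (Set.Ici 0) t) :
    ∀ t, 0 ≤ t → orbitDistSq x (γ t) < ρ := by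
  by_contra! hcon
  obtain ⟨t₁, ht₁, hDt₁⟩ := hcon
  have hD : ContinuousOn (fun t => orbitDistSq x (γ t)) (Set.Ici 0) :=
    (continuous_orbitDistSq x).comp_continuousOn hγ
  have hsub : ∀ t, Set.Icc 0 t ⊆ Set.Ici (0 : ℝ) := fun t s hs => hs.1
  -- the first time at which the distance is reached
  have hcpt : IsCompact (Set.Icc 0 t₁ ∩ (fun t => orbitDistSq x (γ t)) ⁻¹' Set.Ici ρ) :=
    isCompact_Icc.of_isClosed_subset
      ((hD.mono (hsub t₁)).preimage_isClosed_of_isClosed isClosed_Icc isClosed_Ici)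
      Set.inter_subset_left
  obtain ⟨t₀, ⟨ht₀, hDt₀⟩, hleast⟩ := hcpt.exists_isLeast ⟨t₁, ⟨ht₁, le_rfl⟩, hDt₁⟩
  have hbefore : ∀ s ∈ Set.Ico 0 t₀, orbitDistSq x (γ s) < ρ := by
    intro s hs
    by_contra! hs'
    exact absurd (hleast ⟨⟨hs.1, hs.2.le.trans ht₀.2⟩, hs'⟩) (not_le.2 hs.2)
  have hDeq : orbitDistSq x (γ t₀) = ρ := by
    obtain ⟨s, hs, hsρ⟩ := intermediate_value_Icc ht₀.1 (hD.mono (hsub t₀)) ⟨h0.le, hDt₀⟩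
    rcases hs.2.lt_or_eq with h' | h'
    · exact absurd hsρ (hbefore s ⟨hs.1, h'⟩).ne
    · rw [← h']; exact hsρ
  have hle : ∀ s ∈ Set.Icc 0 t₀, orbitDistSq x (γ s) ≤ ρ := by
    intro s hs
    rcases hs.2.lt_or_eq with h' | h'
    · exact (hbefore s ⟨hs.1, h'⟩).le
    · rw [h', hDeq]
  have hderH : ∀ s ∈ Set.Icc 0 t₀,
      HasDerivWithinAt (fun t => hamiltonian Γ Ω' (γ t)) 0 (Set.Ici 0) s := by
    intro s hs
    have hz := hphase _ (hle s hs)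
    have h1 := ((contDiffAt_hamiltonian Γ Ω' hz).differentiableAt
      (by simp)).hasFDerivAt.comp_hasDerivWithinAt s (hder s hs.1 (hle s hs))
    refine h1.congr_deriv ?_
    rw [map_smul, fderiv_hamiltonian_velocity Γ Ω Ω' hz, smul_zero]
  have hconst := constant_of_has_deriv_right_zero
    (fun s hs => (hderH s hs).continuousWithinAt.mono (hsub t₀))
    (fun s hs => (hderH s ⟨hs.1, hs.2.le⟩).mono (Set.Ici_subset_Ici.2 hs.1))
    t₀ ⟨ht₀.1, le_rfl⟩
  have := hbar _ hDeq
  rw [hconst] at this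
  linarith

/-- A relative equilibrium at which the second derivative of the augmented Hamiltonian is negative
definite transversally to the orbit is Lyapunov stable modulo rotations. -/
theorem lyapunovStable_of_negDef (Γ : ι → ℝ) (Ω Ω' : ℝ) {x : ι → ℂ} (hx : x ∈ phaseSpace ι)
    (hcrit : velocity Γ Ω' x = 0)
    (hneg : ∀ v ∈ orbitNormal x, v ≠ 0 →
      symplecticForm Γ (fderiv ℝ (velocity Γ Ω') x v) v < 0) :
    LyapunovStable Γ Ω x := by
  intro U hU hUinv hxU
  have hdH : ∀ z ∈ phaseSpace ι, DifferentiableAt ℝ (hamiltonian Γ Ω') z := fun z hz =>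
    (contDiffAt_hamiltonian Γ Ω' hz).differentiableAt (by simp)
  -- the negative of the Hamiltonian grows quadratically
  obtain ⟨c, hc, δ₀, hδ₀, hgrow⟩ := exists_quadratic_growth
    (f := fun z => -hamiltonian Γ Ω' z) (x := x)
    (q := -(symplecticCLM Γ).comp (fderiv ℝ (velocity Γ Ω') x))
    (by
      filter_upwards [isOpen_phaseSpace.mem_nhds hx] with z hz
      exact (hdH z hz).neg)
    (by
      rw [fderiv_fun_neg, neg_eq_zero]
      ext v
      rw [fderiv_hamiltonian_apply Γ Ω' hx, hcrit, ← symplecticCLM_apply, map_zero])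
    (by
      have h1 : fderiv ℝ (fun z => -hamiltonian Γ Ω' z) = fun z => -fderiv ℝ (hamiltonian Γ Ω') z :=
        funext fun z => fderiv_fun_neg
      rw [h1]
      exact (hasFDerivAt_fderiv_hamiltonian Γ Ω' hx).neg)
    (orbitNormal x) (fun v hv hv0 => neg_pos.2 (hneg v hv hv0))
  obtain ⟨ε, hε, hball⟩ := Metric.isOpen_iff.1 (hU.inter isOpen_phaseSpace) x ⟨hxU, hx⟩
  set δ := min δ₀ (ε / 2) with hδ
  have hδpos : 0 < δ := lt_min hδ₀ (by positivity)
  have hnorm : ∀ z θ, ∑ j, ‖(rotate θ z - x) j‖ ^ 2 ≤ δ ^ 2 → ‖rotate θ z - x‖ ≤ δ := by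
    intro z θ h
    refine (pi_norm_le_iff_of_nonneg hδpos.le).2 fun j => ?_
    have h1 := (Finset.single_le_sum (fun i _ => sq_nonneg ‖(rotate θ z - x) i‖)
      (mem_univ j)).trans h
    exact (pow_le_pow_iff_left₀ (norm_nonneg _) hδpos.le two_ne_zero).1 h1
  have hnear : ∀ z, orbitDistSq x z ≤ δ ^ 2 → z ∈ U ∧ z ∈ phaseSpace ι ∧ ‖z‖ ≤ ‖x‖ + δ ∧
      c * orbitDistSq x z ≤
        Fintype.card ι * (hamiltonian Γ Ω' x - hamiltonian Γ Ω' z) := by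
    intro z hz
    obtain ⟨θ, hθ, hsum⟩ := exists_rotate_sub_mem_orbitNormal x z
    have hv := hnorm z θ (hsum.trans_le hz)
    have hmem : rotate θ z ∈ U ∩ phaseSpace ι := hball (by
      rw [Metric.mem_ball, dist_eq_norm]
      exact hv.trans_lt ((min_le_right _ _).trans_lt (by linarith)))
    have hback : rotate (-θ) (rotate θ z) = z := by
      rw [← rotate_add, neg_add_cancel, rotate_zero]
    refine ⟨hback ▸ hUinv (-θ) _ hmem.1, hback ▸ rotate_mem_phaseSpace hmem.2 (-θ), ?_, ?_⟩
    · refine (pi_norm_le_iff_of_nonneg (by positivity)).2 fun j => ?_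
      rw [← norm_rotate_apply θ z j]
      refine (norm_le_pi_norm _ j).trans ?_
      have := norm_add_le x (rotate θ z - x)
      rw [add_sub_cancel] at this
      linarith
    · have h1 := hgrow _ hθ (hv.trans (min_le_left _ _))
      rw [add_sub_cancel, hamiltonian_rotate] at h1
      have h2 : orbitDistSq x z ≤ Fintype.card ι * ‖rotate θ z - x‖ ^ 2 := by
        rw [← hsum, ← nsmul_eq_mul, ← Finset.card_univ]
        refine Finset.sum_le_card_nsmul _ _ _ fun j _ => ?_
        exact pow_le_pow_left₀ (norm_nonneg _) (norm_le_pi_norm _ j) 2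
      have h3 : (0 : ℝ) ≤ Fintype.card ι := by positivity
      nlinarith
  -- the value of the Hamiltonian that is not exceeded at the distance `δ` from the orbit
  set h := hamiltonian Γ Ω' x - c * δ ^ 2 / (Fintype.card ι + 1) with hh
  have hn1 : (0 : ℝ) < (Fintype.card ι : ℝ) + 1 := by positivity
  have hgap : 0 < c * δ ^ 2 / (Fintype.card ι + 1) := by positivity
  have hbar : ∀ z, orbitDistSq x z = δ ^ 2 → hamiltonian Γ Ω' z ≤ h := by
    intro z hz
    have h1 := (hnear z hz.le).2.2.2
    rw [hz] at h1
    have h2 : c * δ ^ 2 / (Fintype.card ι + 1) * (Fintype.card ι + 1) = c * δ ^ 2 := by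
      field_simp
    have h3 : (0 : ℝ) ≤ Fintype.card ι := by positivity
    by_contra! h4
    nlinarith
  set V : Set (ι → ℂ) := {z | z ∈ phaseSpace ι ∧ orbitDistSq x z < δ ^ 2 ∧ h < hamiltonian Γ Ω' z}
    with hV
  have hVopen : IsOpen V := by
    have h1 : ContinuousOn (hamiltonian Γ Ω') (phaseSpace ι) := fun z hz =>
      (hdH z hz).continuousAt.continuousWithinAt
    have h2 := h1.isOpen_inter_preimage isOpen_phaseSpace (isOpen_Ioi (a := h))
    have h3 := (isOpen_Iio (a := δ ^ 2)).preimage (continuous_orbitDistSq x)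
    convert h2.inter h3 using 1
    ext z
    simp only [hV, Set.mem_ofPred_eq, Set.mem_inter_iff, Set.mem_preimage, Set.mem_Ioi, Set.mem_Iio]
    tauto
  refine ⟨V, hVopen, ⟨hx, by rw [orbitDistSq_self]; positivity, by linarith⟩,
    fun z hz => (hnear z hz.2.1.le).1, fun y hy => ⟨?_, ?_⟩⟩
  · have hK : IsCompact {z | orbitDistSq x z ≤ δ ^ 2} := by
      refine Metric.isCompact_of_isClosed_isBounded
        (isClosed_le (continuous_orbitDistSq x) continuous_const) ?_
      exact (Metric.isBounded_closedBall (x := (0 : ι → ℂ)) (r := ‖x‖ + δ)).subset fun z hz => by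
        simpa using (hnear z hz).2.2.1
    obtain ⟨χ, hχ, ⟨L, hL⟩, C, hC⟩ := exists_cutoff isOpen_phaseSpace
      (fun z hz => contDiffAt_velocity Γ Ω hz) hK fun z hz => (hnear z hz).2.1
    obtain ⟨γ, hγ0, hγ⟩ := exists_global_solution hL hC y
    have hstay := orbitDistSq_lt_of_conserved Γ Ω Ω' (fun z hz => (hnear z hz).2.1) hbar
      (fun t _ => (hγ t).continuousAt.continuousWithinAt) (hγ0 ▸ hy.2.1) (hγ0 ▸ hy.2.2)
      (fun t => χ (γ t)) fun t _ _ => (hγ t).hasDerivWithinAt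
    refine ⟨γ, fun t ht => ?_, hγ0⟩
    have ht' := (hstay t ht).le
    refine ⟨(hnear _ ht').2.1, ((hγ t).congr_deriv ?_).hasDerivWithinAt⟩
    rw [hχ _ ht', one_smul]
  · intro γ hγ hγ0 t ht
    have hstay := orbitDistSq_lt_of_conserved Γ Ω Ω' (fun z hz => (hnear z hz).2.1) hbar
      (fun t ht => (hγ t ht).2.continuousWithinAt) (hγ0 ▸ hy.2.1) (hγ0 ▸ hy.2.2)
      (fun _ => 1) fun t ht _ => by simpa using (hγ t ht).2
    exact (hnear _ (hstay t ht).le).1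

end Stability

/-! ### Definiteness of the second derivative at the ring -/

lemma im_coeff_linearization_mul_conj (hR : 0 < R) (v : Option (Fin N) → ℂ) {k : ℕ} (hk : k ≤ N) :
    (coeff k (fun j => linearization N l R v (some j)) *
      (starRingEnd ℂ) (coeff k fun j => v (some j))).im =
      -(frequency R * (diagCoeff N l * ‖coeff k fun j => v (some j)‖ ^ 2 -
        pairCoeff N l k *
          ((coeff k fun j => v (some j)) * coeff (-k) fun j => v (some j)).re -
        2 * l * (if (N : ℤ) ∣ (k : ℤ) - 1 then (N : ℝ) else 0) *
          ((coeff k fun j => v (some j)) * v none).re)) := by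
  rw [coeff_linearization hR v hk]
  have hif : (if (N : ℤ) ∣ (k : ℤ) - 1 then (N : ℂ) else 0) =
      ((if (N : ℤ) ∣ (k : ℤ) - 1 then (N : ℝ) else 0 : ℝ) : ℂ) := by split_ifs <;> simp
  rw [hif]
  simp only [Complex.sq_norm, Complex.normSq_apply, Complex.mul_re, Complex.mul_im, Complex.add_re,
    Complex.add_im, Complex.neg_re, Complex.neg_im, Complex.conj_re, Complex.conj_im,
    Complex.I_re, Complex.I_im, Complex.ofReal_re, Complex.ofReal_im, Complex.re_ofNat,
    Complex.im_ofNat]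
  ring

/-- A lower bound for the contribution of a mode to minus the second derivative. -/
lemma pair_form_ge {A B : ℝ} {a b : ℂ} :
    A * ‖a‖ ^ 2 - |B| * (‖a‖ ^ 2 + ‖b‖ ^ 2) / 2 ≤ A * ‖a‖ ^ 2 - B * (a * b).re := by
  have h1 : |(a * b).re| ≤ ‖a‖ * ‖b‖ := by
    rw [← norm_mul]; exact Complex.abs_re_le_norm _
  have h2 : B * (a * b).re ≤ |B| * (‖a‖ * ‖b‖) := by
    refine (le_abs_self _).trans ?_
    rw [abs_mul]
    exact mul_le_mul_of_nonneg_left h1 (abs_nonneg B)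
  have h3 : ‖a‖ * ‖b‖ ≤ (‖a‖ ^ 2 + ‖b‖ ^ 2) / 2 := by nlinarith [sq_nonneg (‖a‖ - ‖b‖)]
  have h4 := mul_le_mul_of_nonneg_left h3 (abs_nonneg B)
  linarith

/-- The contribution of the modes that move the central vortex, as a sum of squares. -/
lemma central_form_eq {A l n : ℝ} {a b c : ℂ} :
    A * (A * ‖a‖ ^ 2 + A * ‖b‖ ^ 2 + 4 * l * (a * b).re + n * l * (A * ‖c‖ ^ 2) -
      4 * l * n * (a * c).re) =
    ‖A * b + 2 * l * (starRingEnd ℂ) a‖ ^ 2 + n * l * ‖A * c - 2 * (starRingEnd ℂ) a‖ ^ 2 +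
      (A ^ 2 - 4 * l ^ 2 - 4 * l * n) * ‖a‖ ^ 2 := by
  simp only [Complex.sq_norm, Complex.normSq_apply, Complex.mul_re, Complex.mul_im, Complex.add_re,
    Complex.add_im, Complex.sub_re, Complex.sub_im, Complex.conj_re, Complex.conj_im,
    Complex.ofReal_re, Complex.ofReal_im, Complex.re_ofNat, Complex.im_ofNat]
  ring

lemma overlap_ring (v : Option (Fin N) → ℂ) :
    overlap (ringWithCentre N R) v = R * coeff 0 (fun j => v (some j)) := by
  rw [overlap, Fintype.sum_option, coeff, Finset.mul_sum, ringWithCentre_none, map_zero, zero_mul,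
    zero_add]
  refine Finset.sum_congr rfl fun j _ => ?_
  rw [ringWithCentre_some, map_mul, Complex.conj_ofReal, conj_vertex, zero_add, zpow_neg_one,
    mul_assoc]

/-- The second derivative at the ring is negative definite on displacements orthogonal to the orbit
if each pair of modes has a coupling smaller than `diagCoeff N l`. -/
theorem symplecticForm_linearization_neg (hN : 3 ≤ N) (hR : 0 < R) (hl0 : 0 < l)
    (hl : 4 * l < ((N : ℝ) - 1) ^ 2)
    (hB : ∀ k : ℕ, 2 ≤ k → k + 2 ≤ N → |pairCoeff N l k| < diagCoeff N l)
    {v : Option (Fin N) → ℂ} (hv : v ∈ orbitNormal (ringWithCentre N R)) (hv0 : v ≠ 0) :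
    symplecticForm (ringStrength N l) (linearization N l R v) v < 0 := by
  have hκ := frequency_pos hR
  have hNR : (3 : ℝ) ≤ N := by exact_mod_cast hN
  have hA : 0 < diagCoeff N l := by unfold diagCoeff; linarith
  have hdisc : 0 < diagCoeff N l ^ 2 - 4 * l ^ 2 - 4 * l * N := by
    rw [diagCoeff_sq_sub]; linarith
  have him : (coeff 0 fun j => v (some j)).im = 0 := by
    rw [mem_orbitNormal, overlap_ring, Complex.im_ofReal_mul] at hv
    exact (mul_eq_zero.1 hv).resolve_left hR.ne'
  set f : ℤ → ℂ := fun k => coeff k fun j => v (some j) with hf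
  set c := v none with hc
  -- `T k` is the contribution of the index `k` to minus the form, in units of `frequency R`
  set T : ℕ → ℝ := fun k => diagCoeff N l * ‖f k‖ ^ 2 - pairCoeff N l k * (f k * f (-k)).re -
    2 * l * (if (N : ℤ) ∣ (k : ℤ) - 1 then (N : ℝ) else 0) * (f k * c).re with hT
  have hform : N * symplecticForm (ringStrength N l) (linearization N l R v) v =
      -(frequency R * (∑ k ∈ range N, T k +
        N * l * (diagCoeff N l * ‖c‖ ^ 2 - 2 * (f 1 * c).re))) := by
    have h1 := congrArg Complex.im
      (sum_coeff_mul_conj (fun j => linearization N l R v (some j)) fun j => v (some j))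
    rw [Complex.im_sum, Finset.sum_congr rfl fun k hk =>
      im_coeff_linearization_mul_conj (l := l) hR v (Finset.mem_range.1 hk).le,
      Finset.sum_neg_distrib, ← Finset.mul_sum, ← Complex.ofReal_natCast, Complex.im_ofReal_mul,
      Complex.im_sum] at h1
    have h2 : symplecticForm (ringStrength N l) (linearization N l R v) v =
        l * (linearization N l R v none * (starRingEnd ℂ) c).im +
        ∑ j, (linearization N l R v (some j) * (starRingEnd ℂ) (v (some j))).im := by
      rw [symplecticForm, Fintype.sum_option]
      congr 1
      · simp only [ringStrength, Complex.mul_im, Complex.conj_re, Complex.conj_im, ← hc]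
        ring
      · refine Finset.sum_congr rfl fun j _ => ?_
        simp only [ringStrength, Complex.mul_im, Complex.conj_re, Complex.conj_im]
        ring
    have h3 : (linearization N l R v none * (starRingEnd ℂ) c).im =
        -(frequency R * (diagCoeff N l * ‖c‖ ^ 2 - 2 * (f 1 * c).re)) := by
      rw [linearization_none hN hR]
      simp only [Complex.sq_norm, Complex.normSq_apply, Complex.mul_re, Complex.mul_im,
        Complex.add_im, Complex.add_re, Complex.neg_re, Complex.neg_im, Complex.conj_re,
        Complex.conj_im, Complex.I_re, Complex.I_im, Complex.ofReal_re, Complex.ofReal_im,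
        Complex.re_ofNat, Complex.im_ofNat, ← hc, hf]
      ring
    rw [h2, h3, mul_add, ← h1]
    ring
  obtain ⟨M, rfl⟩ : ∃ M, N = M + 3 := ⟨N - 3, by omega⟩
  have hper : ∀ {m n : ℤ}, ((M + 3 : ℕ) : ℤ) ∣ m - n → f m = f n := fun h => coeff_congr h _
  have hsplit : ∑ k ∈ range (M + 3), T k = T 0 + T 1 + ∑ k ∈ range M, T (k + 2) + T (M + 2) := by
    rw [Finset.sum_range_succ, Finset.sum_range_succ', Finset.sum_range_succ']
    ring
  have hT0 : T 0 = 2 * diagCoeff (M + 3) l * (f 0).re ^ 2 := by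
    have hd : ¬ ((M + 3 : ℕ) : ℤ) ∣ ((0 : ℕ) : ℤ) - 1 :=
      not_dvd_of_lt (by omega) (by omega) (by omega)
    have hB0 : pairCoeff (M + 3) l 0 = -diagCoeff (M + 3) l := by
      unfold pairCoeff diagCoeff; push_cast; ring
    have him' : (f 0).im = 0 := him
    simp only [hT]
    rw [if_neg hd]
    simp only [hB0, Nat.cast_zero, neg_zero, Complex.sq_norm, Complex.normSq_apply,
      Complex.mul_re, him']
    ring
  have hT1 : T 1 + T (M + 2) = diagCoeff (M + 3) l * ‖f 1‖ ^ 2 + diagCoeff (M + 3) l * ‖f (-1)‖ ^ 2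
      + 4 * l * (f 1 * f (-1)).re - 2 * l * (M + 3 : ℕ) * (f 1 * c).re := by
    have hd : ¬ ((M + 3 : ℕ) : ℤ) ∣ ((M + 2 : ℕ) : ℤ) - 1 :=
      not_dvd_of_lt (by omega) (by omega) (by omega)
    have e1 : f ((M + 2 : ℕ) : ℤ) = f (-1) := hper ⟨1, by push_cast; ring⟩
    have e2 : f (-((M + 2 : ℕ) : ℤ)) = f 1 := hper ⟨-1, by push_cast; ring⟩
    have hBM : pairCoeff (M + 3) l (M + 2) = -(2 * l) := by
      rw [← pairCoeff_one (N := M + 3), ← pairCoeff_reflect (by omega)]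
      congr 1
      omega
    have hd1 : ((M + 3 : ℕ) : ℤ) ∣ ((1 : ℕ) : ℤ) - 1 := by simp
    simp only [hT, if_neg hd, if_pos hd1, hBM, pairCoeff_one, e1, e2, mul_comm (f (-1)) (f 1)]
    push_cast
    ring
  have hTk : ∀ k ∈ range M, diagCoeff (M + 3) l * ‖f ((k + 2 : ℕ) : ℤ)‖ ^ 2 -
      |pairCoeff (M + 3) l (k + 2)| *
        (‖f ((k + 2 : ℕ) : ℤ)‖ ^ 2 + ‖f (-((k + 2 : ℕ) : ℤ))‖ ^ 2) / 2 ≤ T (k + 2) := by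
    intro k hk
    have hk' := Finset.mem_range.1 hk
    have hd : ¬ ((M + 3 : ℕ) : ℤ) ∣ ((k + 2 : ℕ) : ℤ) - 1 :=
      not_dvd_of_lt (by omega) (by omega) (by omega)
    simp only [hT, if_neg hd, mul_zero, zero_mul, sub_zero]
    exact pair_form_ge
  -- the indices `k` and `-k` run through the same residues and have the same coupling
  have hreflect : ∑ k ∈ range M, |pairCoeff (M + 3) l (k + 2)| * ‖f (-((k + 2 : ℕ) : ℤ))‖ ^ 2 =
      ∑ k ∈ range M, |pairCoeff (M + 3) l (k + 2)| * ‖f ((k + 2 : ℕ) : ℤ)‖ ^ 2 := by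
    rw [← Finset.sum_range_reflect]
    refine Finset.sum_congr rfl fun k hk => ?_
    have hk' := Finset.mem_range.1 hk
    have e1 : M - 1 - k + 2 = M + 3 - (k + 2) := by omega
    have e2 : f (-((M + 3 - (k + 2) : ℕ) : ℤ)) = f ((k + 2 : ℕ) : ℤ) := hper ⟨-1, by omega⟩
    rw [e1, pairCoeff_reflect (by omega), e2]
  have hmid : ∑ k ∈ range M, (diagCoeff (M + 3) l - |pairCoeff (M + 3) l (k + 2)|) *
      ‖f ((k + 2 : ℕ) : ℤ)‖ ^ 2 ≤ ∑ k ∈ range M, T (k + 2) := by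
    refine le_trans (le_of_eq ?_) (Finset.sum_le_sum hTk)
    simp only [sub_mul, mul_add, add_div, Finset.sum_sub_distrib, Finset.sum_add_distrib,
      ← Finset.sum_div]
    rw [hreflect]
    ring
  have hmid0 : ∀ k ∈ range M, 0 ≤ (diagCoeff (M + 3) l - |pairCoeff (M + 3) l (k + 2)|) *
      ‖f ((k + 2 : ℕ) : ℤ)‖ ^ 2 := fun k hk =>
    mul_nonneg (sub_nonneg.2 (hB (k + 2) (by omega)
      (by have := Finset.mem_range.1 hk; omega)).le) (sq_nonneg _)
  have hcen := central_form_eq (A := diagCoeff (M + 3) l) (l := l) (n := (M + 3 : ℕ)) (a := f 1)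
    (b := f (-1)) (c := c)
  set Q := diagCoeff (M + 3) l * ‖f 1‖ ^ 2 + diagCoeff (M + 3) l * ‖f (-1)‖ ^ 2 +
    4 * l * (f 1 * f (-1)).re + (M + 3 : ℕ) * l * (diagCoeff (M + 3) l * ‖c‖ ^ 2) -
      4 * l * (M + 3 : ℕ) * (f 1 * c).re with hQ
  have hn : (0 : ℝ) < (M + 3 : ℕ) := by positivity
  have t1 := sq_nonneg ‖(diagCoeff (M + 3) l : ℂ) * f (-1) + 2 * l * (starRingEnd ℂ) (f 1)‖
  have t2 : 0 ≤ (M + 3 : ℕ) * l *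
      ‖(diagCoeff (M + 3) l : ℂ) * c - 2 * (starRingEnd ℂ) (f 1)‖ ^ 2 := by positivity
  have t3 := mul_nonneg hdisc.le (sq_nonneg ‖f 1‖)
  have hQ0 : 0 ≤ Q := by
    by_contra! h
    have := mul_neg_of_pos_of_neg hA h
    linarith
  have hT00 : 0 ≤ T 0 := by rw [hT0]; positivity
  have hsum0 := Finset.sum_nonneg hmid0
  have htot : ∑ k ∈ range (M + 3), T k +
      (M + 3 : ℕ) * l * (diagCoeff (M + 3) l * ‖c‖ ^ 2 - 2 * (f 1 * c).re) =
      T 0 + ∑ k ∈ range M, T (k + 2) + Q := by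
    rw [hsplit, hQ]
    linear_combination hT1
  rw [htot] at hform
  by_contra! hge
  have hneg : T 0 + ∑ k ∈ range M, T (k + 2) + Q ≤ 0 := by
    have h1 := mul_nonneg hn.le hge
    rw [hform] at h1
    by_contra! h2
    have := mul_pos hκ h2
    linarith
  have z0 : T 0 = 0 := by linarith
  have zQ : Q = 0 := by linarith
  have zmid : ∑ k ∈ range M, (diagCoeff (M + 3) l - |pairCoeff (M + 3) l (k + 2)|) *
      ‖f ((k + 2 : ℕ) : ℤ)‖ ^ 2 = 0 := by linarith
  rw [zQ, mul_zero] at hcen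
  have s3 : ‖f 1‖ ^ 2 = 0 := (mul_eq_zero.1 (by linarith :
    (diagCoeff (M + 3) l ^ 2 - 4 * l ^ 2 - 4 * l * (M + 3 : ℕ)) * ‖f 1‖ ^ 2 = 0)).resolve_left
      hdisc.ne'
  have f1 : f 1 = 0 := by simpa using s3
  have hAC : (diagCoeff (M + 3) l : ℂ) ≠ 0 := by exact_mod_cast hA.ne'
  rw [f1] at hcen t2
  simp only [map_zero, mul_zero, add_zero, sub_zero, norm_zero, norm_mul, ne_eq,
    OfNat.ofNat_ne_zero, not_false_eq_true, zero_pow] at hcen t2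
  have s1 : (‖(diagCoeff (M + 3) l : ℂ)‖ * ‖f (-1)‖) ^ 2 = 0 := by
    have := sq_nonneg (‖(diagCoeff (M + 3) l : ℂ)‖ * ‖f (-1)‖)
    linarith
  have s2 : (M + 3 : ℕ) * l * (‖(diagCoeff (M + 3) l : ℂ)‖ * ‖c‖) ^ 2 = 0 := by
    have := sq_nonneg (‖(diagCoeff (M + 3) l : ℂ)‖ * ‖f (-1)‖)
    linarith
  have f1' : f (-1) = 0 := by
    simpa [hA.ne'] using s1
  have c0 : c = 0 := by
    have := (mul_eq_zero.1 s2).resolve_left (by positivity)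
    simpa [hA.ne'] using this
  have f0 : f 0 = 0 := by
    rw [hT0] at z0
    have h1 : (f 0).re ^ 2 = 0 := (mul_eq_zero.1 z0).resolve_left (by positivity)
    exact Complex.ext (by simpa using h1) him
  refine hv0 (eq_zero_of_coeff_slice c0 f0 f1 f1' fun k h1 h2 => ?_)
  have h3 := (Finset.sum_eq_zero_iff_of_nonneg hmid0).1 zmid (k - 2)
    (Finset.mem_range.2 (by omega))
  rw [show k - 2 + 2 = k by omega] at h3
  have h4 := (mul_eq_zero.1 h3).resolve_left (sub_pos.2 (hB k h1 h2)).ne'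
  simpa using h4

theorem lyapunovStable_ring (hN : 3 ≤ N) (hR : 0 < R) (Ω : ℝ) (hl0 : 0 < l)
    (hl : 4 * l < ((N : ℝ) - 1) ^ 2)
    (hB : ∀ k : ℕ, 2 ≤ k → k + 2 ≤ N → |pairCoeff N l k| < diagCoeff N l) :
    LyapunovStable (ringStrength N l) Ω (ringWithCentre N R) := by
  refine lyapunovStable_of_negDef _ Ω (-(frequency R * diagCoeff N l))
    (ringWithCentre_mem_phaseSpace hR) ?_
    fun v hv hv0 => symplecticForm_linearization_neg hN hR hl0 hl hB hv hv0
  have h := sub_ringAngularVelocity (N := N) (l := l) (R := R) (-(frequency R * diagCoeff N l))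
  have h' : ringAngularVelocity N l R (-(frequency R * diagCoeff N l)) = 0 := by linarith
  rw [velocity_ring hN hR, h']
  funext j
  simp

/-- Above the lower threshold every pair of modes has a coupling smaller than `diagCoeff N l`. -/
lemma abs_pairCoeff_lt (hl : lowerThreshold N < l) {k : ℕ} (h1 : 2 ≤ k) (h2 : k + 2 ≤ N) :
    |pairCoeff N l k| < diagCoeff N l := by
  have h3 := diagCoeff_sub_pairCoeff_ge (N := N) (l := l) k
  have h4 := diagCoeff_add_pairCoeff (N := N) (l := l) k
  have h5 : (2 : ℝ) ≤ k := by exact_mod_cast h1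
  have h6 : (k : ℝ) + 2 ≤ N := by exact_mod_cast h2
  have h7 : (0 : ℝ) < k * (N - k) := mul_pos (by linarith) (by linarith)
  rw [abs_lt]
  constructor <;> linarith

end PointVortex

theorem theorem5 (N : ℕ) (hN : 3 ≤ N) (l : ℝ) (hl : l ≠ 0) (R : ℝ) (hR : 0 < R) (Ω : ℝ) :
    PointVortex.IsRelativeEquilibrium (PointVortex.ringStrength N l) Ω
      (PointVortex.ringWithCentre N R) (PointVortex.ringAngularVelocity N l R Ω) ∧
    (4 ≤ N →
      (max 0 (PointVortex.lowerThreshold N) < l → l < ((N : ℝ) - 1) ^ 2 / 4 →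
        PointVortex.LyapunovStable (PointVortex.ringStrength N l) Ω
          (PointVortex.ringWithCentre N R)) ∧
      (PointVortex.lowerThreshold N < l → l < 0 →
        PointVortex.Elliptic (PointVortex.ringStrength N l) Ω
          (PointVortex.ringAngularVelocity N l R Ω) (PointVortex.ringWithCentre N R)) ∧
      (¬ (max 0 (PointVortex.lowerThreshold N) < l ∧ l < ((N : ℝ) - 1) ^ 2 / 4) →
        ¬ (PointVortex.lowerThreshold N < l ∧ l < 0) →
        PointVortex.LinearlyUnstable (PointVortex.ringStrength N l) Ω
          (PointVortex.ringAngularVelocity N l R Ω) (PointVortex.ringWithCentre N R)) ∧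
      (l < PointVortex.lowerThreshold N ∨ ((N : ℝ) - 1) ^ 2 / 4 < l →
        PointVortex.SpectrallyUnstable (PointVortex.ringStrength N l) Ω
          (PointVortex.ringAngularVelocity N l R Ω) (PointVortex.ringWithCentre N R))) ∧
    (N = 3 →
      (0 < l → l < 1 →
        PointVortex.LyapunovStable (PointVortex.ringStrength N l) Ω
          (PointVortex.ringWithCentre N R)) ∧
      (l < 0 →
        PointVortex.Elliptic (PointVortex.ringStrength N l) Ω
          (PointVortex.ringAngularVelocity N l R Ω) (PointVortex.ringWithCentre N R)) ∧
      (1 < l →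
        PointVortex.LinearlyUnstable (PointVortex.ringStrength N l) Ω
          (PointVortex.ringAngularVelocity N l R Ω) (PointVortex.ringWithCentre N R) ∧
        PointVortex.SpectrallyUnstable (PointVortex.ringStrength N l) Ω
          (PointVortex.ringAngularVelocity N l R Ω) (PointVortex.ringWithCentre N R))) := by
  have hB2 : PointVortex.lowerThreshold N < l → ∀ k : ℕ, 2 ≤ k → k + 2 ≤ N →
      PointVortex.pairCoeff N l k ^ 2 ≤ PointVortex.diagCoeff N l ^ 2 := fun h k h1 h2 =>
    sq_le_sq.2 ((PointVortex.abs_pairCoeff_lt h h1 h2).le.trans (le_abs_self _))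
  refine ⟨PointVortex.isRelativeEquilibrium_ring hN hR Ω, fun hN4 => ⟨?_, ?_, ?_, ?_⟩, ?_⟩
  · intro h1 h2
    exact PointVortex.lyapunovStable_ring hN hR Ω ((le_max_left _ _).trans_lt h1) (by linarith)
      fun k => PointVortex.abs_pairCoeff_lt ((le_max_right _ _).trans_lt h1)
  · intro h1 h2
    exact ⟨PointVortex.spectrallyStable_ring hN hR Ω (by nlinarith [sq_nonneg ((N : ℝ) - 1)])
      (hB2 h1), PointVortex.not_definiteOnSlice_ring hN hR Ω h2⟩
  · intro h1 h2
    by_cases h3 : l ≤ PointVortex.lowerThreshold N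
    · exact (PointVortex.linearlyUnstable_of_le_lowerThreshold hN4 hR Ω h3).1
    · have h3' := not_le.1 h3
      have h4 : 0 < l := lt_of_le_of_ne (not_lt.1 fun h => h2 ⟨h3', h⟩) hl.symm
      exact (PointVortex.linearlyUnstable_of_ge_upperThreshold hN hR Ω
        (not_lt.1 fun h => h1 ⟨max_lt h4 h3', h⟩)).1
  · rintro (h | h)
    · exact (PointVortex.linearlyUnstable_of_le_lowerThreshold hN4 hR Ω h.le).2 h
    · exact (PointVortex.linearlyUnstable_of_ge_upperThreshold hN hR Ω h.le).2 h
  · rintro rfl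
    -- a triangle has no pair of modes besides those that move the central vortex
    refine ⟨fun h1 h2 => ?_, fun h1 => ⟨?_, ?_⟩, fun h1 => ?_⟩
    · exact PointVortex.lyapunovStable_ring hN hR Ω h1 (by push_cast; linarith)
        fun k h3 h4 => by omega
    · exact PointVortex.spectrallyStable_ring hN hR Ω (by push_cast; linarith)
        fun k h3 h4 => by omega
    · exact PointVortex.not_definiteOnSlice_ring hN hR Ω h1
    · have h := PointVortex.linearlyUnstable_of_ge_upperThreshold (l := l) hN hR Ω
        (by push_cast; linarith)
      exact ⟨h.1, h.2 (by push_cast; linarith)⟩
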